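/- There are universal constants $C,c>0$ with the following property. Let $q\ge 2$, $d,m\in\mathbb N$, and let $s_0,\dots,s_{q-1}\in\mathbb R^{q-1}$ be a simplex code, i.e. $\|s_j\|=1$, $\langle s_j,s_i\rangle=-\frac1{q-1}$ for $i\ne j$, and $\sum_j s_j=0$. Let $\mathbb B^d$ be the closed Euclidean unit ball of $\mathbb R^d$, let $K\subset\mathbb R^d$, and let $x\in K\cap\mathbb B^d$ be a signal normalized by $\|x\|=1$. Let $w(K)=\mathbb E\sup_{u\in K-K}\langle g,u\rangle\in[0,\infty]$, $g\sim\mathcal N(0,I_d)$, be the Gaussian mean width of $K$. Let $W_1,\dots,W_m$ be independent Gaussian random matrices in $\mathbb R^{(q-1)\times d}$ (with independent $\mathcal N(0,1)$ entries), let $y_i\in\arg\max_{0\le j\le q-1}\langle s_j,W_ix\rangle$, $i=1,\dots,m$, be the $q$-ary quantized measurements of $x$, and let the decoder's output be a solution $$\hat x_m\in\arg\max_{u\in K\cap\mathbb B^d}\ \frac1m\sum_{i=1}^m\langle s_{y_i},W_iu\rangle .$$ If $\delta>0$ and $m\ge C\delta^{-2}w(K)^2$, then with probability at least $1-8\exp(-c\delta^2m)$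 every such solution satisfies $$\|\hat x_m-x\|^2\le\frac{\delta}{\sqrt{\log q}} .$$ (For $q=2$, where $s_0=-s_1=\pm1$, this is the setting of $1$-bit compressive sensing.) -/

import Mathlib

open MeasureTheory ProbabilityTheory
open scoped ENNReal RealInnerProductSpace

/-- A simplex code: unit vectors `s 0, …, s (q-1)` of `ℝ^(q-1)` with pairwise inner products
`-1/(q-1)` and sum zero. -/
structure IsSimplexCode (q : ℕ) (s : Fin q → EuclideanSpace ℝ (Fin (q - 1))) : Prop where
  norm_sq : ∀ j, ‖s j‖ ^ 2 = 1
  inner_eq : ∀ i j, i ≠ j → ⟪s j, s i⟫ = -(1 / ((q : ℝ) - 1))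
  sum_eq_zero : ∑ j, s j = 0

/-- `W 0, …, W (m-1)` are independent `k × d` Gaussian random matrices: all their `m * k * d` entries
are jointly independent and have law `N(0,1)`. -/
structure IsGaussianMatrixFamily {Ω : Type*} [MeasurableSpace Ω] (μ : Measure Ω) {m k d : ℕ}
    (W : Fin m → Ω → Matrix (Fin k) (Fin d) ℝ) : Prop where
  hasLaw : ∀ i a b, HasLaw (fun ω => W i ω a b) (gaussianReal 0 1) μ
  indep : iIndepFun (fun (p : Fin m × Fin k × Fin d) (ω : Ω) => W p.1 ω p.2.1 p.2.2) μ

/-- `j` is a `q`-ary quantized measurement of `x`: it attains the maximum of `⟨s_j, W x⟩`. -/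
def IsQuantizedMeasurement {q d : ℕ} (s : Fin q → EuclideanSpace ℝ (Fin (q - 1)))
    (W : Matrix (Fin (q - 1)) (Fin d) ℝ) (x : EuclideanSpace ℝ (Fin d)) (j : Fin q) : Prop :=
  ∀ k : Fin q, ⟪s k, W.toEuclideanLin x⟫ ≤ ⟪s j, W.toEuclideanLin x⟫

/-- `y` is the `q`-ary sensing of `x` by the matrices `W i`. -/
def IsSensing {q d m : ℕ} (s : Fin q → EuclideanSpace ℝ (Fin (q - 1)))
    (W : Fin m → Matrix (Fin (q - 1)) (Fin d) ℝ) (x : EuclideanSpace ℝ (Fin d))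
    (y : Fin m → Fin q) : Prop :=
  ∀ i, IsQuantizedMeasurement s (W i) x (y i)

/-- The decoder's objective `(1/m) ∑ i, ⟨s_{y i}, W i u⟩`. -/
noncomputable def decoderObjective {q d m : ℕ} (s : Fin q → EuclideanSpace ℝ (Fin (q - 1)))
    (W : Fin m → Matrix (Fin (q - 1)) (Fin d) ℝ) (y : Fin m → Fin q)
    (u : EuclideanSpace ℝ (Fin d)) : ℝ :=
  (1 / (m : ℝ)) * ∑ i, ⟪s (y i), (W i).toEuclideanLin u⟫

/-- `xhat` is an output of the decoder: a maximizer of the objective over `K ∩ 𝔹^d`, where `𝔹^d`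
is the closed Euclidean unit ball. -/
def IsDecoded {q d m : ℕ} (s : Fin q → EuclideanSpace ℝ (Fin (q - 1)))
    (K : Set (EuclideanSpace ℝ (Fin d))) (W : Fin m → Matrix (Fin (q - 1)) (Fin d) ℝ)
    (y : Fin m → Fin q) (xhat : EuclideanSpace ℝ (Fin d)) : Prop :=
  xhat ∈ K ∩ Metric.closedBall 0 1 ∧
    ∀ u ∈ K ∩ Metric.closedBall 0 1, decoderObjective s W y u ≤ decoderObjective s W y xhat

/-- The Gaussian mean width `w(K) = 𝔼 sup_{u ∈ K - K} ⟨g, u⟩`, `g ∼ N(0, I_d)`, with values in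
`[0, ∞]`. For nonempty `K` the supremum is nonnegative (take `u = 0`), so `ENNReal.ofReal` does not
change it. -/
noncomputable def gaussianMeanWidth {d : ℕ} (K : Set (EuclideanSpace ℝ (Fin d))) : ℝ≥0∞ :=
  ∫⁻ g, ⨆ a ∈ K, ⨆ b ∈ K, ENNReal.ofReal ⟪g, a - b⟫
    ∂(stdGaussian (EuclideanSpace ℝ (Fin d)))

/-!
Write `obj u = (1 / m) ∑ i, ⟪s (y i), W i u⟫` for the decoder's objective and decompose
`u = ⟪x, u⟫ x + P u`, with `P` the orthogonal projection onto `xᗮ`. Then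
`√m * obj u = ⟪x, u⟫ * S + ⟪V, P u⟫`, where the *signal* `S = √m * obj x` is
`(1 / √m) ∑ i, max_j ⟪s j, W i x⟫` and `V = (1 / √m) ∑ i, (W i)ᵀ (s (y i))` is the *noise*.
Optimality of the decoded vector against `x` gives
`(1 - ⟪x, xhat⟫) * S ≤ ⟪V, P (xhat - x)⟫`, and `‖xhat - x‖ ^ 2 ≤ 2 (1 - ⟪x, xhat⟫)` because `xhat`
is in the unit ball (`norm_sub_sq_mul_le_of_isDecoded`). It remains to bound the signal from below
and the noise from above.

* Noise. For a fixed pattern `σ` in place of `y`, the vector `V` is standard Gaussian on `ℝ^d`, and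
  `P V` is independent of all `W i x`, hence of the event that `σ` is the sensing of `x`. Summing
  over `σ` (ties are null events) shows that `P V` has the law of the projection of a standard
  Gaussian vector `g`, in spite of the dependence of `y` on `W`
  (`IsSimplexCode.measure_noise_le`). The mean of `sup ⟪g, P (u - x)⟫` is at most the mean width of
  `K`, by averaging `g` with its reflection in `xᗮ`, and the supremum concentrates around its mean.
* Signal. `S` is a maximum of linear forms of norm one in the entries of the `W i`, with mean at
  least `√m * 𝔼 max_j ⟪s j, z⟫` for `z` standard Gaussian, so it is at least half of this with high
  probability. The last mean is at least of order `√(log q)`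
  (`exists_sqrt_log_le_integral_maxInner`): the numbers `⟪s j, z⟫` have the covariance of a
  recentred family of `q` independent Gaussian variables.

Both steps use Gaussian concentration for maxima of linear forms of norm at most one, with a
constant independent of the dimension (`measure_maxInner_deviation_le`). It is proved by the
rotation argument of Maurey and Pisier: two independent copies `x`, `y` are joined by a quarter circle, whose
points and tangents are again independent standard Gaussian vectors. The path is discretized and
differentiability is replaced by convexity, so that maxima need not be smoothed.
-/

/-! ### Linear images of the standard Gaussian measure -/

lemma ofReal_integral_le_lintegral_ofReal {α : Type*} [MeasurableSpace α] {μ : Measure α}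
    {f : α → ℝ} (hf : Integrable f μ) :
    ENNReal.ofReal (∫ x, f x ∂μ) ≤ ∫⁻ x, ENNReal.ofReal (f x) ∂μ := by
  have h : ∫ x, f x ∂μ ≤ ∫ x, max (f x) 0 ∂μ :=
    integral_mono hf hf.pos_part fun x => le_max_left _ _
  refine (ENNReal.ofReal_le_ofReal h).trans ?_
  rw [ofReal_integral_eq_lintegral_ofReal hf.pos_part (ae_of_all _ fun x => le_max_right _ _)]
  refine lintegral_mono fun x => ?_
  rcases le_total (f x) 0 with h | h <;> simp [h, ENNReal.ofReal_of_nonpos]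

section GaussianLinear

variable {H H' E E' : Type*}
  [NormedAddCommGroup H] [InnerProductSpace ℝ H] [FiniteDimensional ℝ H] [MeasurableSpace H]
  [BorelSpace H]
  [NormedAddCommGroup H'] [InnerProductSpace ℝ H'] [FiniteDimensional ℝ H'] [MeasurableSpace H']
  [BorelSpace H']
  [NormedAddCommGroup E] [InnerProductSpace ℝ E] [FiniteDimensional ℝ E] [MeasurableSpace E]
  [BorelSpace E]
  [NormedAddCommGroup E'] [InnerProductSpace ℝ E'] [FiniteDimensional ℝ E'] [MeasurableSpace E']
  [BorelSpace E']

lemma charFun_stdGaussian_map_adjoint (A : E →L[ℝ] H) (t : E) :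
    charFun ((stdGaussian H).map (ContinuousLinearMap.adjoint A)) t =
      Complex.exp (-‖A t‖ ^ 2 / 2) := by
  rw [← charFun_stdGaussian, charFun_apply, charFun_apply,
    integral_map (by fun_prop) (by fun_prop)]
  simp_rw [ContinuousLinearMap.adjoint_inner_left]

/-- The law of `A† g`, with `g` standard Gaussian, depends on `A` only through the norms `‖A t‖`,
that is, through the covariance `A† A`. -/
lemma stdGaussian_map_adjoint_congr (A : E →L[ℝ] H) (B : E →L[ℝ] H')
    (h : ∀ t, ‖A t‖ = ‖B t‖) :
    (stdGaussian H).map (ContinuousLinearMap.adjoint A) =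
      (stdGaussian H').map (ContinuousLinearMap.adjoint B) := by
  have : IsProbabilityMeasure ((stdGaussian H).map (ContinuousLinearMap.adjoint A)) :=
    Measure.isProbabilityMeasure_map (by fun_prop)
  have : IsProbabilityMeasure ((stdGaussian H').map (ContinuousLinearMap.adjoint B)) :=
    Measure.isProbabilityMeasure_map (by fun_prop)
  refine Measure.ext_of_charFun (funext fun t => ?_)
  rw [charFun_stdGaussian_map_adjoint, charFun_stdGaussian_map_adjoint, h]

lemma stdGaussian_map_adjoint_of_isometry (A : E →L[ℝ] H) (h : ∀ t, ‖A t‖ = ‖t‖) :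
    (stdGaussian H).map (ContinuousLinearMap.adjoint A) = stdGaussian E := by
  rw [stdGaussian_map_adjoint_congr A (ContinuousLinearMap.id ℝ E) h,
    ContinuousLinearMap.adjoint_id]
  exact Measure.map_id

lemma covariance_inner_stdGaussian (a b : H) :
    cov[fun w => ⟪a, w⟫, fun w => ⟪b, w⟫; stdGaussian H] = ⟪a, b⟫ := by
  rw [← covarianceBilin_apply_eq_cov IsGaussian.memLp_two_id, covarianceBilin_stdGaussian]
  rfl

/-- Linear images of a standard Gaussian vector whose covariance vanishes are independent. -/
lemma indepFun_adjoint_stdGaussian (A : E →L[ℝ] H) (B : E' →L[ℝ] H)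
    (h : ∀ s t, ⟪A s, B t⟫ = 0) :
    IndepFun (ContinuousLinearMap.adjoint A) (ContinuousLinearMap.adjoint B) (stdGaussian H) := by
  have hid : HasGaussianLaw (id : H → H) (stdGaussian H) := IsGaussian.hasGaussianLaw_id
  refine HasGaussianLaw.indepFun_of_covariance_inner
    (hid.map_fun ((ContinuousLinearMap.adjoint A).prod (ContinuousLinearMap.adjoint B))) ?_
  intro s t
  simp only [ContinuousLinearMap.adjoint_inner_right]
  rw [covariance_inner_stdGaussian, h]

lemma stdGaussian_map_inner (a : H) :
    (stdGaussian H).map (fun w => ⟪a, w⟫) = gaussianReal 0 (‖a‖₊ ^ 2) := by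
  have h := IsGaussian.map_eq_gaussianReal (μ := stdGaussian H) (innerSL ℝ a)
  rw [integral_strongDual_stdGaussian, variance_dual_stdGaussian, innerSL_apply_norm] at h
  rwa [Real.toNNReal_pow (norm_nonneg a), norm_toNNReal] at h

lemma stdGaussian_inner_eq_zero {a : H} (ha : a ≠ 0) :
    stdGaussian H {w | ⟪a, w⟫ = 0} = 0 := by
  have h : {w : H | ⟪a, w⟫ = 0} = (fun w => ⟪a, w⟫) ⁻¹' {0} := rfl
  have hv : ‖a‖₊ ^ 2 ≠ 0 := by simpa using ha
  have := nullSingletonClass_gaussianReal (μ := 0) hv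
  rw [h, ← Measure.map_apply (by fun_prop) (measurableSet_singleton _), stdGaussian_map_inner]
  simp

lemma lintegral_exp_inner_stdGaussian (a : H) :
    ∫⁻ w, ENNReal.ofReal (Real.exp ⟪a, w⟫) ∂(stdGaussian H) =
      ENNReal.ofReal (Real.exp (‖a‖ ^ 2 / 2)) := by
  have h1 : ∫⁻ w, ENNReal.ofReal (Real.exp ⟪a, w⟫) ∂(stdGaussian H) =
      ∫⁻ y, ENNReal.ofReal (Real.exp y) ∂(gaussianReal 0 (‖a‖₊ ^ 2)) := by
    rw [← stdGaussian_map_inner, lintegral_map (by fun_prop) (by fun_prop)]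
  have h2 := integrable_exp_mul_gaussianReal (μ := 0) (v := ‖a‖₊ ^ 2) 1
  have h3 := congrFun (mgf_id_gaussianReal (μ := 0) (v := ‖a‖₊ ^ 2)) 1
  simp only [one_mul] at h2
  rw [h1, ← ofReal_integral_eq_lintegral_ofReal h2 (ae_of_all _ fun _ => (Real.exp_pos _).le)]
  simp only [mgf, id, one_mul] at h3
  rw [h3]
  simp

lemma integrable_exp_mul_norm_stdGaussian (t : ℝ) :
    Integrable (fun w : H => Real.exp (t * ‖w‖)) (stdGaussian H) := by
  obtain ⟨c, hc, hint⟩ := IsGaussian.exists_integrable_exp_sq (stdGaussian H)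
  refine (hint.const_mul (Real.exp (t ^ 2 / (4 * c)))).mono' (by fun_prop) (ae_of_all _ fun w => ?_)
  rw [Real.norm_of_nonneg (Real.exp_pos _).le, ← Real.exp_add, Real.exp_le_exp]
  have : t ^ 2 / (4 * c) + c * ‖w‖ ^ 2 - t * ‖w‖ = (t - 2 * c * ‖w‖) ^ 2 / (4 * c) := by
    field_simp; ring
  have : 0 ≤ (t - 2 * c * ‖w‖) ^ 2 / (4 * c) := by positivity
  linarith

end GaussianLinear

/-! ### Gaussian concentration for convex functions -/

section Concentration

variable {E : Type*} [NormedAddCommGroup E] [InnerProductSpace ℝ E] [FiniteDimensional ℝ E]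
  [MeasurableSpace E] [BorelSpace E]

lemma tendsto_lintegral_exp_mul_norm_stdGaussian :
    Filter.Tendsto (fun ε : ℝ => ∫⁻ w : E, ENNReal.ofReal (Real.exp (ε * ‖w‖)) ∂(stdGaussian E))
      (nhds 0) (nhds 1) := by
  have hc : Continuous (mgf (fun w : E => ‖w‖) (stdGaussian E)) :=
    continuous_mgf integrable_exp_mul_norm_stdGaussian
  have h := (ENNReal.continuous_ofReal.comp hc).tendsto 0
  simp only [Function.comp_apply, mgf_zero, ENNReal.ofReal_one] at h
  refine h.congr fun ε => ?_
  rw [Function.comp_apply, mgf, ofReal_integral_eq_lintegral_ofReal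
    (integrable_exp_mul_norm_stdGaussian ε) (ae_of_all _ fun _ => (Real.exp_pos _).le)]

/-- One step of the rotation argument: the increment along a rotation by the angle `h` has a
first-order part `⟪G x, y⟫` with `y` independent of `x`, whose exponential moment is explicit. -/
lemma lintegral_exp_rotation_step {G : E → E} (hG : Measurable G) (hG1 : ∀ x, ‖G x‖ ≤ 1)
    {s h : ℝ} (hs : 0 ≤ s) :
    ∫⁻ p : E × E, ENNReal.ofReal (Real.exp (s * ⟪G p.1,
        (1 - Real.cos h) • p.1 + Real.sin h • p.2⟫)) ∂((stdGaussian E).prod (stdGaussian E)) ≤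
      ENNReal.ofReal (Real.exp ((s * h) ^ 2 / 2)) *
        ∫⁻ w : E, ENNReal.ofReal (Real.exp (s * h ^ 2 / 2 * ‖w‖)) ∂(stdGaussian E) := by
  rw [lintegral_prod _ (by fun_prop), ← lintegral_const_mul _ (by fun_prop)]
  refine lintegral_mono fun x => ?_
  have hcos : 1 - Real.cos h ≤ h ^ 2 / 2 := by linarith [Real.one_sub_sq_div_two_le_cos (x := h)]
  have hcos0 : 0 ≤ 1 - Real.cos h := by linarith [Real.cos_le_one h]
  have hsin : Real.sin h ^ 2 ≤ h ^ 2 := sq_le_sq.2 Real.abs_sin_le_abs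
  have e : ∀ y : E, ENNReal.ofReal (Real.exp (s * ⟪G x,
        (1 - Real.cos h) • x + Real.sin h • y⟫)) =
      ENNReal.ofReal (Real.exp (s * ((1 - Real.cos h) * ⟪G x, x⟫))) *
        ENNReal.ofReal (Real.exp ⟪(s * Real.sin h) • G x, y⟫) := by
    intro y
    rw [← ENNReal.ofReal_mul (Real.exp_pos _).le, ← Real.exp_add, inner_add_right,
      inner_smul_right, inner_smul_right, real_inner_smul_left]
    ring_nf
  simp_rw [e]
  have hquad : ‖(s * Real.sin h) • G x‖ ^ 2 ≤ (s * h) ^ 2 := by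
    rw [norm_smul, mul_pow, Real.norm_eq_abs, sq_abs, mul_pow, mul_pow]
    have : ‖G x‖ ^ 2 ≤ 1 := pow_le_one₀ (norm_nonneg _) (hG1 x)
    calc s ^ 2 * Real.sin h ^ 2 * ‖G x‖ ^ 2 ≤ s ^ 2 * h ^ 2 * 1 := by gcongr
      _ = _ := by ring
  have hlin : s * ((1 - Real.cos h) * ⟪G x, x⟫) ≤ s * h ^ 2 / 2 * ‖x‖ := by
    have h1 : ⟪G x, x⟫ ≤ ‖x‖ := (real_inner_le_norm _ _).trans
      (mul_le_of_le_one_left (norm_nonneg _) (hG1 x))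
    have h2 : (1 - Real.cos h) * ⟪G x, x⟫ ≤ h ^ 2 / 2 * ‖x‖ :=
      (mul_le_mul_of_nonneg_left h1 hcos0).trans
        (mul_le_mul_of_nonneg_right hcos (norm_nonneg _))
    calc s * ((1 - Real.cos h) * ⟪G x, x⟫) ≤ s * (h ^ 2 / 2 * ‖x‖) :=
          mul_le_mul_of_nonneg_left h2 hs
      _ = _ := by ring
  rw [lintegral_const_mul _ (by fun_prop), lintegral_exp_inner_stdGaussian, mul_comm]
  exact mul_le_mul' (ENNReal.ofReal_le_ofReal (Real.exp_le_exp.2 (by linarith)))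
    (ENNReal.ofReal_le_ofReal (Real.exp_le_exp.2 hlin))

lemma lintegral_comp_rotation (θ : ℝ) {f : E × E → ℝ≥0∞} (hf : Measurable f) :
    ∫⁻ p, f (ContinuousLinearMap.rotation θ p) ∂((stdGaussian E).prod (stdGaussian E)) =
      ∫⁻ p, f p ∂((stdGaussian E).prod (stdGaussian E)) := by
  have h := IsGaussian.map_rotation_eq_self (μ := (stdGaussian E)) (by simp) θ
  conv_rhs => rw [← h]
  rw [lintegral_map hf (by fun_prop)]

/-- The discretized rotation argument of Maurey and Pisier: the path from `x` to `y` along a quarter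
circle is cut into `N` steps, convexity of `F` bounds the increment of every step, and convexity of
the exponential separates the steps. -/
lemma lintegral_exp_sub_le_aux {F : E → ℝ} {G : E → E} (hG : Measurable G)
    (hG1 : ∀ x, ‖G x‖ ≤ 1) (hsub : ∀ x y, F y - F x ≤ ⟪G y, y - x⟫) {t : ℝ} (ht : 0 ≤ t)
    {N : ℕ} (hN : 0 < N) :
    ∫⁻ p : E × E, ENNReal.ofReal (Real.exp (t * (F p.2 - F p.1)))
        ∂((stdGaussian E).prod (stdGaussian E)) ≤
      ENNReal.ofReal (Real.exp (t ^ 2 * Real.pi ^ 2 / 8)) *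
        ∫⁻ w : E, ENNReal.ofReal (Real.exp (t * Real.pi ^ 2 / 8 / N * ‖w‖)) ∂(stdGaussian E) := by
  have hN' : (0 : ℝ) < N := by exact_mod_cast hN
  set h : ℝ := Real.pi / 2 / N with hh
  set Φ : E × E → ℝ := fun p => ⟪G p.1, (1 - Real.cos h) • p.1 + Real.sin h • p.2⟫ with hΦ
  have hΦm : Measurable Φ := by fun_prop
  -- `X p k` is the point at the angle `k * h` on the arc from `p.1` to `p.2`.
  set X : E × E → ℕ → E := fun p k =>
    (ContinuousLinearMap.rotation (k * h) p).1 with hX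
  have hstep : ∀ p k, F (X p (k + 1)) - F (X p k) ≤
      Φ (ContinuousLinearMap.rotation ((k + 1 : ℕ) * h) p) := by
    intro p k
    refine (hsub _ _).trans (le_of_eq ?_)
    simp only [hΦ, hX, ContinuousLinearMap.rotation_apply]
    congr 1
    have hk : (k : ℝ) * h = ((k + 1 : ℕ) : ℝ) * h - h := by push_cast; ring
    rw [hk, Real.cos_sub, Real.sin_sub]
    module
  have htel : ∀ p : E × E, F p.2 - F p.1 ≤
      ∑ k ∈ Finset.range N, Φ (ContinuousLinearMap.rotation ((k + 1 : ℕ) * h) p) := by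
    intro p
    have h0 : X p 0 = p.1 := by simp [hX, ContinuousLinearMap.rotation_apply]
    have h1 : X p N = p.2 := by
      have : (N : ℝ) * h = Real.pi / 2 := by rw [hh]; field_simp
      simp [hX, ContinuousLinearMap.rotation_apply, this]
    rw [← h0, ← h1, ← Finset.sum_range_sub (fun k => F (X p k))]
    exact Finset.sum_le_sum fun k _ => hstep p k
  have hpt : ∀ p : E × E, ENNReal.ofReal (Real.exp (t * (F p.2 - F p.1))) ≤
      ∑ k ∈ Finset.range N, ENNReal.ofReal (N : ℝ)⁻¹ * ENNReal.ofReal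
        (Real.exp (t * N * Φ (ContinuousLinearMap.rotation ((k + 1 : ℕ) * h) p))) := by
    intro p
    have hconv := convexOn_exp.map_sum_le (t := Finset.range N) (w := fun _ => (N : ℝ)⁻¹)
      (p := fun k => t * N * Φ (ContinuousLinearMap.rotation ((k + 1 : ℕ) * h) p))
      (fun _ _ => by positivity) (by simp [hN'.ne']) (fun _ _ => Set.mem_univ _)
    simp_rw [← ENNReal.ofReal_mul (inv_nonneg.2 hN'.le)]
    rw [← ENNReal.ofReal_sum_of_nonneg (fun _ _ => by positivity)]
    refine ENNReal.ofReal_le_ofReal (le_trans (Real.exp_le_exp.2 ?_) hconv)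
    have : ∑ i ∈ Finset.range N, (N : ℝ)⁻¹ • (t * N *
          Φ (ContinuousLinearMap.rotation ((i + 1 : ℕ) * h) p)) =
        t * ∑ k ∈ Finset.range N, Φ (ContinuousLinearMap.rotation ((k + 1 : ℕ) * h) p) := by
      rw [Finset.mul_sum]
      refine Finset.sum_congr rfl fun k _ => ?_
      rw [smul_eq_mul]; field_simp
    rw [this]
    exact mul_le_mul_of_nonneg_left (htel p) ht
  calc _ ≤ ∫⁻ p : E × E, ∑ k ∈ Finset.range N, ENNReal.ofReal (N : ℝ)⁻¹ * ENNReal.ofReal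
        (Real.exp (t * N * Φ (ContinuousLinearMap.rotation ((k + 1 : ℕ) * h) p)))
          ∂((stdGaussian E).prod (stdGaussian E)) :=
        lintegral_mono hpt
    _ = ∑ k ∈ Finset.range N, ENNReal.ofReal (N : ℝ)⁻¹ * ∫⁻ p : E × E, ENNReal.ofReal
        (Real.exp (t * N * Φ p)) ∂((stdGaussian E).prod (stdGaussian E)) := by
      rw [lintegral_finsetSum _ (fun k _ => by fun_prop)]
      refine Finset.sum_congr rfl fun k _ => ?_
      rw [lintegral_const_mul _ (by fun_prop), lintegral_comp_rotation ((k + 1 : ℕ) * h)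
        (f := fun p => ENNReal.ofReal (Real.exp (t * N * Φ p))) (by fun_prop)]
    _ = ∫⁻ p : E × E, ENNReal.ofReal (Real.exp (t * N * Φ p))
        ∂((stdGaussian E).prod (stdGaussian E)) := by
      rw [Finset.sum_const, Finset.card_range, nsmul_eq_mul, ← mul_assoc,
        ENNReal.ofReal_inv_of_pos hN', ENNReal.ofReal_natCast,
        ENNReal.mul_inv_cancel (by exact_mod_cast hN.ne') (ENNReal.natCast_ne_top N), one_mul]
    _ ≤ _ := lintegral_exp_rotation_step hG hG1 (by positivity)
    _ = _ := by
      have h1 : (t * N * h) ^ 2 / 2 = t ^ 2 * Real.pi ^ 2 / 8 := by rw [hh]; field_simp; ring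
      have h2 : t * N * h ^ 2 / 2 = t * Real.pi ^ 2 / 8 / N := by rw [hh]; field_simp; ring
      rw [h1, h2]

/-- A convex function `F` with a measurable selection `G` of subgradients of norm at most `1` has
sub-Gaussian increments between two independent standard Gaussian vectors. -/
lemma lintegral_exp_sub_le {F : E → ℝ} {G : E → E} (hG : Measurable G)
    (hG1 : ∀ x, ‖G x‖ ≤ 1) (hsub : ∀ x y, F y - F x ≤ ⟪G y, y - x⟫) (t : ℝ) :
    ∫⁻ p : E × E, ENNReal.ofReal (Real.exp (t * (F p.2 - F p.1)))
        ∂((stdGaussian E).prod (stdGaussian E)) ≤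
      ENNReal.ofReal (Real.exp (t ^ 2 * Real.pi ^ 2 / 8)) := by
  wlog ht : 0 ≤ t generalizing t
  · have h := this (-t) (by linarith)
    rw [← lintegral_prod_swap] at h
    simp only [Prod.fst_swap, Prod.snd_swap, neg_sq] at h
    refine le_trans (le_of_eq (lintegral_congr fun p => ?_)) h
    ring_nf
  have hlim : Filter.Tendsto (fun N : ℕ => ENNReal.ofReal (Real.exp (t ^ 2 * Real.pi ^ 2 / 8)) *
        ∫⁻ w : E, ENNReal.ofReal (Real.exp (t * Real.pi ^ 2 / 8 / N * ‖w‖)) ∂(stdGaussian E))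
      Filter.atTop (nhds (ENNReal.ofReal (Real.exp (t ^ 2 * Real.pi ^ 2 / 8)) * 1)) :=
    ENNReal.Tendsto.const_mul (tendsto_lintegral_exp_mul_norm_stdGaussian.comp
      (tendsto_const_div_atTop_nhds_zero_nat _)) (Or.inr ENNReal.ofReal_ne_top)
  rw [mul_one] at hlim
  refine ge_of_tendsto hlim ?_
  filter_upwards [Filter.eventually_gt_atTop 0] with N hN
  exact lintegral_exp_sub_le_aux hG hG1 hsub ht hN

/-- Jensen's inequality in the second variable turns the bound for `F y - F x` into one for the
deviation of `F` from its mean. -/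
lemma lintegral_exp_sub_integral_le {F : E → ℝ} (hF : Measurable F)
    (hFi : Integrable F (stdGaussian E)) {G : E → E} (hG : Measurable G)
    (hG1 : ∀ x, ‖G x‖ ≤ 1) (hsub : ∀ x y, F y - F x ≤ ⟪G y, y - x⟫) (t : ℝ) :
    ∫⁻ y, ENNReal.ofReal (Real.exp (t * (F y - ∫ x, F x ∂(stdGaussian E)))) ∂(stdGaussian E) ≤
      ENNReal.ofReal (Real.exp (t ^ 2 * Real.pi ^ 2 / 8)) := by
  set M := ∫ x, F x ∂(stdGaussian E) with hM
  refine le_trans ?_ (lintegral_exp_sub_le hG hG1 hsub t)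
  have hsplit : ∀ p : E × E, ENNReal.ofReal (Real.exp (t * (F p.2 - F p.1))) =
      ENNReal.ofReal (Real.exp (-t * (F p.1 - M))) *
        ENNReal.ofReal (Real.exp (t * (F p.2 - M))) := by
    intro p
    rw [← ENNReal.ofReal_mul (Real.exp_pos _).le, ← Real.exp_add]
    ring_nf
  simp_rw [hsplit]
  rw [lintegral_prod_mul (f := fun x => ENNReal.ofReal (Real.exp (-t * (F x - M))))
    (g := fun x => ENNReal.ofReal (Real.exp (t * (F x - M)))) (by fun_prop) (by fun_prop)]
  refine le_mul_of_one_le_left zero_le ?_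
  have hi : Integrable (fun x => -t * (F x - M) + 1) (stdGaussian E) := by fun_prop
  calc (1 : ℝ≥0∞) = ENNReal.ofReal (∫ x, (-t * (F x - M) + 1) ∂(stdGaussian E)) := by
        rw [integral_add (by fun_prop) (by fun_prop), integral_const_mul,
          integral_sub hFi (by fun_prop)]
        simp [hM]
    _ ≤ ∫⁻ x, ENNReal.ofReal (-t * (F x - M) + 1) ∂(stdGaussian E) :=
        ofReal_integral_le_lintegral_ofReal hi
    _ ≤ _ := lintegral_mono fun x => ENNReal.ofReal_le_ofReal (Real.add_one_le_exp _)

/-- Gaussian concentration: both the upper (`ε = 1`) and the lower (`ε = -1`) deviations of a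
convex function with subgradients of norm at most `1` have Gaussian tails. -/
lemma measure_deviation_le {F : E → ℝ} (hF : Measurable F) (hFi : Integrable F (stdGaussian E))
    {G : E → E} (hG : Measurable G) (hG1 : ∀ x, ‖G x‖ ≤ 1)
    (hsub : ∀ x y, F y - F x ≤ ⟪G y, y - x⟫) {r : ℝ} (hr : 0 ≤ r) {ε : ℝ} (hε : ε ^ 2 = 1) :
    stdGaussian E {y | r ≤ ε * (F y - ∫ x, F x ∂(stdGaussian E))} ≤
      ENNReal.ofReal (Real.exp (-(r ^ 2 / 5))) := by
  set M := ∫ x, F x ∂(stdGaussian E) with hM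
  -- The exponent `2 r / 5` is close to the optimal `4 r / π ^ 2`.
  set a : ℝ := 2 * r / 5 with ha
  have hpi : Real.pi ^ 2 ≤ 10 := by nlinarith [Real.pi_lt_d2, Real.pi_pos]
  have hmono : {y | r ≤ ε * (F y - M)} ⊆ {y | ENNReal.ofReal (Real.exp (a * r)) ≤
      ENNReal.ofReal (Real.exp (a * ε * (F y - M)))} := by
    intro y hy
    refine ENNReal.ofReal_le_ofReal (Real.exp_le_exp.2 ?_)
    rw [mul_assoc]
    exact mul_le_mul_of_nonneg_left hy (by positivity)
  have hmarkov := meas_ge_le_lintegral_div (μ := stdGaussian E)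
    (f := fun y => ENNReal.ofReal (Real.exp (a * ε * (F y - M)))) (by fun_prop)
    (ε := ENNReal.ofReal (Real.exp (a * r))) (by simp [Real.exp_pos]) ENNReal.ofReal_ne_top
  refine (measure_mono hmono).trans (hmarkov.trans ?_)
  refine (ENNReal.div_le_div_right
    (lintegral_exp_sub_integral_le hF hFi hG hG1 hsub (a * ε)) _).trans ?_
  rw [← ENNReal.ofReal_div_of_pos (Real.exp_pos _), ← Real.exp_sub]
  refine ENNReal.ofReal_le_ofReal (Real.exp_le_exp.2 ?_)
  rw [mul_pow, hε, ha]
  nlinarith [mul_le_mul_of_nonneg_left hpi (sq_nonneg r)]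

end Concentration

/-! ### Maxima of finitely many Gaussian linear forms -/

section MaxInner

variable {E : Type*} [NormedAddCommGroup E] [InnerProductSpace ℝ E] {ι : Type*} [Fintype ι]
  [Nonempty ι]

/-- The support function `x ↦ max_i ⟪x, v i⟫` of a finite nonempty family of vectors. -/
noncomputable def maxInner (v : ι → E) (x : E) : ℝ :=
  Finset.univ.sup' Finset.univ_nonempty fun i => ⟪x, v i⟫

lemma inner_le_maxInner (v : ι → E) (x : E) (i : ι) : ⟪x, v i⟫ ≤ maxInner v x :=
  Finset.le_sup' (fun i => ⟪x, v i⟫) (Finset.mem_univ i)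

lemma exists_maxInner_eq (v : ι → E) (x : E) : ∃ i, maxInner v x = ⟪x, v i⟫ := by
  obtain ⟨i, -, h⟩ := Finset.exists_mem_eq_sup' Finset.univ_nonempty fun i => ⟪x, v i⟫
  exact ⟨i, h⟩

lemma continuous_maxInner (v : ι → E) : Continuous (maxInner v) :=
  Continuous.finset_sup'_apply _ fun i _ => by fun_prop

lemma abs_maxInner_le (v : ι → E) (x : E) : |maxInner v x| ≤ (∑ i, ‖v i‖) * ‖x‖ := by
  obtain ⟨i, hi⟩ := exists_maxInner_eq v x
  rw [hi]
  refine (abs_real_inner_le_norm _ _).trans ?_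
  rw [mul_comm]
  gcongr
  exact Finset.single_le_sum (f := fun i => ‖v i‖) (fun _ _ => norm_nonneg _) (Finset.mem_univ i)

variable [MeasurableSpace E] [BorelSpace E]

/-- A measurable choice of a maximizing vector, which is a subgradient of `maxInner v`. -/
lemma exists_measurable_maximizer [FiniteDimensional ℝ E] (v : ι → E) :
    ∃ G : E → E, Measurable G ∧ (∀ x, ∃ i, G x = v i) ∧ ∀ x i, ⟪x, v i⟫ ≤ ⟪x, G x⟫ := by
  classical
  suffices h : ∀ s : Finset ι, s.Nonempty → ∃ G : E → E, Measurable G ∧ (∀ x, ∃ i, G x = v i) ∧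
      ∀ x, ∀ i ∈ s, ⟪x, v i⟫ ≤ ⟪x, G x⟫ by
    obtain ⟨G, h1, h2, h3⟩ := h Finset.univ Finset.univ_nonempty
    exact ⟨G, h1, h2, fun x i => h3 x i (Finset.mem_univ i)⟩
  intro s hs
  induction hs using Finset.Nonempty.cons_induction with
  | singleton a => exact ⟨fun _ => v a, measurable_const, fun _ => ⟨a, rfl⟩, by simp⟩
  | cons a s ha hs ih =>
    obtain ⟨G, h1, h2, h3⟩ := ih
    refine ⟨fun x => if ⟪x, G x⟫ ≤ ⟪x, v a⟫ then v a else G x,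
      Measurable.ite (measurableSet_le (by fun_prop) (by fun_prop)) measurable_const h1,
      fun x => ?_, fun x i hi => ?_⟩
    · by_cases h : ⟪x, G x⟫ ≤ ⟪x, v a⟫
      · exact ⟨a, by simp [h]⟩
      · simpa [h] using h2 x
    · have hi' := Finset.mem_cons.1 hi
      by_cases h : ⟪x, G x⟫ ≤ ⟪x, v a⟫
      · rcases hi' with rfl | hi'
        · simp [h]
        · simpa [h] using (h3 x i hi').trans h
      · rcases hi' with rfl | hi'
        · simpa [h] using (not_le.1 h).le
        · simpa [h] using h3 x i hi'

variable [FiniteDimensional ℝ E]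

lemma integrable_maxInner (v : ι → E) : Integrable (maxInner v) (stdGaussian E) := by
  refine ((IsGaussian.integrable_id (μ := stdGaussian E)).norm.const_mul (∑ i, ‖v i‖)).mono'
    (continuous_maxInner v).aestronglyMeasurable (ae_of_all _ fun x => ?_)
  exact abs_maxInner_le v x

lemma measure_maxInner_deviation_le (v : ι → E) (hv : ∀ i, ‖v i‖ ≤ 1) {r : ℝ} (hr : 0 ≤ r) {ε : ℝ}
    (hε : ε ^ 2 = 1) :
    stdGaussian E {y | r ≤ ε * (maxInner v y - ∫ x, maxInner v x ∂(stdGaussian E))} ≤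
      ENNReal.ofReal (Real.exp (-(r ^ 2 / 5))) := by
  obtain ⟨G, hG, hGv, hmax⟩ := exists_measurable_maximizer v
  refine measure_deviation_le (continuous_maxInner v).measurable (integrable_maxInner v) hG
    (fun x => ?_) (fun x y => ?_) hr hε
  · obtain ⟨i, hi⟩ := hGv x
    rw [hi]; exact hv i
  · obtain ⟨i, hi⟩ := exists_maxInner_eq v y
    obtain ⟨j, hj⟩ := hGv y
    have h1 := hmax y i
    have h2 := inner_le_maxInner v x j
    rw [inner_sub_right, real_inner_comm, real_inner_comm x, hi]
    rw [← hj] at h2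
    linarith

end MaxInner

/-! ### The expected maximum of a simplex code -/

lemma le_gaussianReal_Ici (τ : ℝ) :
    (√(2 * Real.pi))⁻¹ * Real.exp (-1) * Real.exp (-τ ^ 2) ≤
      (gaussianReal 0 1).real (Set.Ici τ) := by
  have hpt : ∀ x ∈ Set.Icc τ (τ + 1), (√(2 * Real.pi))⁻¹ * Real.exp (-1) * Real.exp (-τ ^ 2) ≤
      gaussianPDFReal 0 1 x := by
    intro x hx
    rw [gaussianPDFReal, mul_assoc, ← Real.exp_add]
    simp only [NNReal.coe_one, mul_one, sub_zero]
    gcongr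
    nlinarith [hx.1, hx.2, sq_nonneg (τ - 1)]
  have h := setIntegral_mono_on (μ := volume)
    (integrableOn_const (by simp)) ((integrable_gaussianPDFReal 0 1).integrableOn)
    measurableSet_Icc hpt
  have h2 : (gaussianReal 0 1).real (Set.Icc τ (τ + 1)) =
      ∫ x in Set.Icc τ (τ + 1), gaussianPDFReal 0 1 x := by
    rw [measureReal_def, gaussianReal_apply_eq_integral _ one_ne_zero, ENNReal.toReal_ofReal]
    exact integral_nonneg fun x => gaussianPDFReal_nonneg _ _ _
  rw [setIntegral_const] at h
  simp only [measureReal_def, Real.volume_Icc, add_sub_cancel_left, ENNReal.ofReal_one,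
    ENNReal.toReal_one, one_smul] at h
  rw [← h2] at h
  exact h.trans (measureReal_mono fun x hx => hx.1)

/-- The probability that, among `n + 1` independent standard Gaussian variables, the first is
nonpositive and another one exceeds `τ`. -/
lemma le_measure_pi_gaussianReal (n : ℕ) (τ : ℝ) :
    (gaussianReal 0 1).real (Set.Iic 0) * (1 - (gaussianReal 0 1).real (Set.Iio τ) ^ n) ≤
      (Measure.pi fun _ : Fin (n + 1) => gaussianReal 0 1).real
        {b | b 0 ≤ 0 ∧ ∃ j, τ ≤ b j ∧ j ≠ 0} := by
  set ν := Measure.pi fun _ : Fin (n + 1) => gaussianReal 0 1 with hν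
  have hbox : ∀ t : Set ℝ, ν.real (Set.univ.pi (Fin.cons (Set.Iic 0) fun _ => t)) =
      (gaussianReal 0 1).real (Set.Iic 0) * (gaussianReal 0 1).real t ^ n := by
    intro t
    rw [measureReal_def, hν, Measure.pi_pi, Fin.prod_univ_succ]
    simp [measureReal_def]
  have hsub : Set.univ.pi (Fin.cons (Set.Iic 0) fun _ => Set.univ) ⊆
      {b : Fin (n + 1) → ℝ | b 0 ≤ 0 ∧ ∃ j, τ ≤ b j ∧ j ≠ 0} ∪
        Set.univ.pi (Fin.cons (Set.Iic 0) fun _ => Set.Iio τ) := by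
    intro b hb
    have h0 : b 0 ≤ 0 := hb 0 (Set.mem_univ _)
    by_cases h : ∃ j : Fin (n + 1), τ ≤ b j ∧ j ≠ 0
    · exact Or.inl ⟨h0, h⟩
    · push Not at h
      refine Or.inr fun j _ => ?_
      refine Fin.cases h0 (fun i => ?_) j
      by_contra hlt
      exact Fin.succ_ne_zero i (h i.succ (not_lt.1 hlt))
  have h := (measureReal_mono (μ := ν) hsub).trans (measureReal_union_le _ _)
  rw [hbox, hbox] at h
  simp only [probReal_univ, one_pow, mul_one] at h
  linarith

section SimplexCode

variable {q : ℕ} {s : Fin q → EuclideanSpace ℝ (Fin (q - 1))}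

lemma IsSimplexCode.norm_sum_sq (hs : IsSimplexCode q s) (hq : 2 ≤ q)
    (t : EuclideanSpace ℝ (Fin q)) :
    ‖∑ j, t j • s j‖ ^ 2 =
      (q : ℝ) / (q - 1) * (‖t‖ ^ 2 - (∑ j, t j) ^ 2 / q) := by
  have hq' : (0 : ℝ) < q - 1 := by
    have : (2 : ℝ) ≤ q := by exact_mod_cast hq
    linarith
  have hq0 : (q : ℝ) ≠ 0 := by positivity
  have hinner : ∀ i j, ⟪s i, s j⟫ =
      -(1 / ((q : ℝ) - 1)) + if i = j then (q : ℝ) / (q - 1) else 0 := by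
    intro i j
    by_cases h : i = j
    · subst h
      rw [real_inner_self_eq_norm_sq, hs.norm_sq, if_pos rfl]
      field_simp
      ring
    · rw [hs.inner_eq j i (Ne.symm h), if_neg h, add_zero]
  rw [← real_inner_self_eq_norm_sq, sum_inner]
  simp_rw [inner_sum, real_inner_smul_left, real_inner_smul_right, hinner, mul_add,
    Finset.sum_add_distrib]
  have h1 : ∑ i, ∑ j, t i * (t j * -(1 / ((q : ℝ) - 1))) =
      -(1 / ((q : ℝ) - 1)) * (∑ j, t j) ^ 2 := by
    rw [sq, Finset.sum_mul_sum, Finset.mul_sum]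
    refine Finset.sum_congr rfl fun i _ => ?_
    rw [Finset.mul_sum]
    exact Finset.sum_congr rfl fun j _ => by ring
  have h2 : ∑ i, ∑ j, t i * (t j * if i = j then (q : ℝ) / (q - 1) else 0) =
      (q : ℝ) / (q - 1) * ‖t‖ ^ 2 := by
    rw [EuclideanSpace.real_norm_sq_eq, Finset.mul_sum]
    refine Finset.sum_congr rfl fun i _ => ?_
    simp only [mul_ite, mul_zero, Finset.sum_ite_eq, Finset.mem_univ, if_true]
    ring
  rw [h1, h2]
  field_simp
  ring

lemma IsSimplexCode.sub_ne_zero (hs : IsSimplexCode q s) (hq : 2 ≤ q) {i j : Fin q} (h : i ≠ j) :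
    s i - s j ≠ 0 := by
  intro h0
  have h1 := hs.inner_eq i j h
  rw [sub_eq_zero.1 h0, real_inner_self_eq_norm_sq, hs.norm_sq] at h1
  have hq' : (2 : ℝ) ≤ q := by exact_mod_cast hq
  have : 0 < 1 / ((q : ℝ) - 1) := by apply one_div_pos.2; linarith
  linarith

/-- The linear map `t ↦ √(q / (q - 1)) (t - mean t)`. -/
noncomputable def centering (q : ℕ) : EuclideanSpace ℝ (Fin q) →L[ℝ] EuclideanSpace ℝ (Fin q) :=
  √((q : ℝ) / (q - 1)) • (ContinuousLinearMap.id ℝ _ -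
    (q : ℝ)⁻¹ • (innerSL ℝ (WithLp.toLp 2 fun _ => 1)).smulRight (WithLp.toLp 2 fun _ => (1 : ℝ)))

lemma centering_apply (t : EuclideanSpace ℝ (Fin q)) (j : Fin q) :
    centering q t j = √((q : ℝ) / (q - 1)) * (t j - (∑ i, t i) / q) := by
  simp [centering, PiLp.inner_apply]
  left; ring

lemma norm_centering_sq (hq : 2 ≤ q) (t : EuclideanSpace ℝ (Fin q)) :
    ‖centering q t‖ ^ 2 = (q : ℝ) / (q - 1) * (‖t‖ ^ 2 - (∑ j, t j) ^ 2 / q) := by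
  have hq' : (0 : ℝ) < q - 1 := by
    have : (2 : ℝ) ≤ q := by exact_mod_cast hq
    linarith
  have hq0 : (q : ℝ) ≠ 0 := by positivity
  simp_rw [EuclideanSpace.real_norm_sq_eq, centering_apply, mul_pow]
  rw [Real.sq_sqrt (by positivity), ← Finset.mul_sum]
  congr 1
  simp_rw [sub_sq, Finset.sum_add_distrib, Finset.sum_sub_distrib, ← Finset.sum_mul,
    ← Finset.mul_sum]
  simp
  field_simp
  ring

lemma inner_centering_single (b : EuclideanSpace ℝ (Fin q)) (j : Fin q) :
    ⟪b, centering q (EuclideanSpace.single j 1)⟫ =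
      √((q : ℝ) / (q - 1)) * (b j - (∑ i, b i) / q) := by
  have h : ∀ i, centering q (EuclideanSpace.single j 1) i * b i =
      √((q : ℝ) / (q - 1)) * ((if i = j then b i else 0) - b i / q) := by
    intro i
    rw [centering_apply]
    have : ∑ k, EuclideanSpace.single j (1 : ℝ) k = 1 := by simp
    rw [this]
    by_cases hij : i = j
    · subst hij; simp; ring
    · simp [hij]; ring
  simp only [PiLp.inner_apply, RCLike.inner_apply, conj_trivial, h]
  rw [← Finset.mul_sum, Finset.sum_sub_distrib, ← Finset.sum_div]
  simp

/-- The vector `(⟪z, s j⟫)_j` has the law of a recentred family of `q` independent Gaussian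
variables, as both are centred Gaussian with the same covariance. -/
lemma IsSimplexCode.integral_maxInner_eq [NeZero q] (hs : IsSimplexCode q s) (hq : 2 ≤ q) :
    ∫ z, maxInner s z ∂(stdGaussian (EuclideanSpace ℝ (Fin (q - 1)))) =
      ∫ b, maxInner (fun j => centering q (EuclideanSpace.single j 1)) b
        ∂(stdGaussian (EuclideanSpace ℝ (Fin q))) := by
  set e : Fin q → EuclideanSpace ℝ (Fin q) := fun j => EuclideanSpace.single j 1 with he
  let A : EuclideanSpace ℝ (Fin q) →L[ℝ] EuclideanSpace ℝ (Fin (q - 1)) :=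
    ∑ j, (innerSL ℝ (e j)).smulRight (s j)
  have hA : ∀ t, A t = ∑ j, t j • s j := by
    intro t
    simp [A, he, EuclideanSpace.inner_single_left]
  have hAe : ∀ j, A (e j) = s j := by
    intro j
    rw [hA]
    simp [he]
  have hlaw := stdGaussian_map_adjoint_congr A (centering q) fun t => by
    rw [← sq_eq_sq₀ (norm_nonneg _) (norm_nonneg _), norm_centering_sq hq, hA,
      hs.norm_sum_sq hq]
  have h1 : ∀ z, maxInner s z = maxInner e (ContinuousLinearMap.adjoint A z) := by
    intro z
    simp only [maxInner, ContinuousLinearMap.adjoint_inner_left, hAe]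
  have h2 : ∀ b, maxInner (fun j => centering q (e j)) b =
      maxInner e (ContinuousLinearMap.adjoint (centering q) b) := by
    intro z
    simp only [maxInner, ContinuousLinearMap.adjoint_inner_left]
  have hm := (continuous_maxInner e).stronglyMeasurable
  rw [integral_congr_ae (ae_of_all _ h1), integral_congr_ae (ae_of_all _ h2),
    ← integral_map (φ := ContinuousLinearMap.adjoint A) (by fun_prop) hm.aestronglyMeasurable,
    ← integral_map (φ := ContinuousLinearMap.adjoint (centering q)) (by fun_prop)
      hm.aestronglyMeasurable, hlaw]

end SimplexCode

/-- The expected maximum is at least `τ` times the probability that the first of the `q` underlying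
independent variables is nonpositive and another one exceeds `τ`. -/
lemma IsSimplexCode.le_integral_maxInner {n : ℕ}
    {s : Fin (n + 1) → EuclideanSpace ℝ (Fin (n + 1 - 1))} (hs : IsSimplexCode (n + 1) s)
    (hn : 1 ≤ n) {τ : ℝ} (hτ : 0 ≤ τ) :
    τ * ((gaussianReal 0 1).real (Set.Iic 0) * (1 - (gaussianReal 0 1).real (Set.Iio τ) ^ n)) ≤
      ∫ z, maxInner s z ∂(stdGaussian (EuclideanSpace ℝ (Fin (n + 1 - 1)))) := by
  rw [hs.integral_maxInner_eq (by lia)]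
  set v : Fin (n + 1) → EuclideanSpace ℝ (Fin (n + 1)) :=
    fun j => centering (n + 1) (EuclideanSpace.single j 1) with hv
  have hint : Integrable (fun b => ⟪b, v 0⟫) (stdGaussian (EuclideanSpace ℝ (Fin (n + 1)))) :=
    IsGaussian.integrable_id.inner_const _
  have hzero : ∫ b, ⟪b, v 0⟫ ∂(stdGaussian (EuclideanSpace ℝ (Fin (n + 1)))) = 0 := by
    have := integral_strongDual_stdGaussian (innerSL ℝ (v 0))
    simpa [real_inner_comm] using this
  have hsub : ∫ b, maxInner v b ∂(stdGaussian (EuclideanSpace ℝ (Fin (n + 1)))) =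
      ∫ b, (maxInner v b - ⟪b, v 0⟫) ∂(stdGaussian (EuclideanSpace ℝ (Fin (n + 1)))) := by
    rw [integral_sub (integrable_maxInner v) hint, hzero, sub_zero]
  rw [hsub]
  have hmarkov := mul_meas_ge_le_integral_of_nonneg
    (μ := stdGaussian (EuclideanSpace ℝ (Fin (n + 1))))
    (f := fun b => maxInner v b - ⟪b, v 0⟫)
    (ae_of_all _ fun b => sub_nonneg.2 (inner_le_maxInner v b 0))
    ((integrable_maxInner v).sub hint) τ
  refine le_trans (mul_le_mul_of_nonneg_left ?_ hτ) hmarkov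
  refine (le_measure_pi_gaussianReal n τ).trans ?_
  have hmeas : MeasurableSet {b : EuclideanSpace ℝ (Fin (n + 1)) | τ ≤ maxInner v b - ⟪b, v 0⟫} :=
    measurableSet_le (by fun_prop) ((continuous_maxInner v).measurable.sub (by fun_prop))
  rw [← map_pi_eq_stdGaussian, map_measureReal_apply (by fun_prop) hmeas]
  refine measureReal_mono ?_
  rintro b ⟨h0, j, hj, -⟩
  have hmax := inner_le_maxInner v (WithLp.toLp 2 b) j
  simp only [hv, Set.mem_preimage, Set.mem_ofPred_eq] at hmax ⊢
  rw [inner_centering_single] at hmax ⊢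
  have hn' : (1 : ℝ) ≤ n := by exact_mod_cast hn
  have hρ : 1 ≤ √(((n + 1 : ℕ) : ℝ) / ((n + 1 : ℕ) - 1)) := by
    rw [Real.one_le_sqrt, one_le_div] <;> push_cast <;> linarith
  have : τ ≤ √(((n + 1 : ℕ) : ℝ) / ((n + 1 : ℕ) - 1)) * (b j - b 0) := by nlinarith
  simp only at hmax ⊢
  linarith

/-- For a simplex code, `𝔼 max_j ⟪s j, z⟫` is at least of order `√(log q)`. -/
theorem exists_sqrt_log_le_integral_maxInner :
    ∃ c : ℝ, 0 < c ∧ ∀ (q : ℕ) [NeZero q], 2 ≤ q →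
      ∀ s : Fin q → EuclideanSpace ℝ (Fin (q - 1)), IsSimplexCode q s →
        c * √(Real.log q) ≤ ∫ z, maxInner s z ∂(stdGaussian (EuclideanSpace ℝ (Fin (q - 1)))) := by
  set a : ℝ := (√(2 * Real.pi))⁻¹ * Real.exp (-1) with ha
  have ha0 : 0 < a := by positivity
  have hp : 0 < (gaussianReal 0 1).real (Set.Iic 0) := by
    have h := le_gaussianReal_Ici 0
    have h2 : (gaussianReal 0 1).real (Set.Ici 0) = (gaussianReal 0 1).real (Set.Iic 0) := by
      conv_rhs => rw [show gaussianReal 0 1 = (gaussianReal 0 1).map (fun x => -x) by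
        rw [gaussianReal_map_neg, neg_zero]]
      rw [map_measureReal_apply (by fun_prop) measurableSet_Iic]
      congr 1
      ext x; simp
    rw [← h2]
    exact lt_of_lt_of_le (by positivity) h
  have hexp : Real.exp (-(a / 2)) < 1 := by rw [Real.exp_lt_one_iff]; linarith
  refine ⟨(gaussianReal 0 1).real (Set.Iic 0) * (1 - Real.exp (-(a / 2))),
    mul_pos hp (by linarith), ?_⟩
  intro q _ hq s hs
  obtain ⟨n, rfl⟩ : ∃ n, q = n + 1 := ⟨q - 1, by lia⟩
  have hn : 1 ≤ n := by lia
  have hn' : (1 : ℝ) ≤ n := by exact_mod_cast hn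
  set τ := √(Real.log ((n + 1 : ℕ) : ℝ)) with hτ
  have hlog : 0 ≤ Real.log ((n + 1 : ℕ) : ℝ) := Real.log_natCast_nonneg _
  have hτ0 : 0 ≤ τ := Real.sqrt_nonneg _
  refine le_trans ?_ (hs.le_integral_maxInner hn hτ0)
  have htail := le_gaussianReal_Ici τ
  rw [← ha, hτ, Real.sq_sqrt hlog, Real.exp_neg (Real.log _), Real.exp_log (by positivity),
    ← hτ] at htail
  have hIio : (gaussianReal 0 1).real (Set.Iio τ) ≤ Real.exp (-(a * ((n + 1 : ℕ) : ℝ)⁻¹)) := by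
    have h1 : (gaussianReal 0 1).real (Set.Iio τ) = 1 - (gaussianReal 0 1).real (Set.Ici τ) := by
      rw [← Set.compl_Ici, probReal_compl_eq_one_sub measurableSet_Ici]
    have h2 := Real.add_one_le_exp (-(a * ((n + 1 : ℕ) : ℝ)⁻¹))
    linarith
  have hpow : (gaussianReal 0 1).real (Set.Iio τ) ^ n ≤ Real.exp (-(a / 2)) := by
    refine (pow_le_pow_left₀ measureReal_nonneg hIio n).trans ?_
    rw [← Real.exp_nat_mul, Real.exp_le_exp]
    have : (1 : ℝ) / 2 ≤ n * ((n + 1 : ℕ) : ℝ)⁻¹ := by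
      push_cast
      rw [← div_eq_mul_inv, div_le_div_iff₀] <;> linarith
    nlinarith
  calc (gaussianReal 0 1).real (Set.Iic 0) * (1 - Real.exp (-(a / 2))) * τ
      = τ * ((gaussianReal 0 1).real (Set.Iic 0) * (1 - Real.exp (-(a / 2)))) := by ring
    _ ≤ _ := by gcongr

/-! ### The Gaussian process projected to a hyperplane -/

section Projection

variable {E : Type*} [NormedAddCommGroup E] [InnerProductSpace ℝ E]

/-- The orthogonal projection onto the hyperplane `xᗮ`. -/
noncomputable abbrev perpProj (x : E) : E →L[ℝ] E := (ℝ ∙ x)ᗮ.starProjection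

lemma perpProj_apply {x : E} (hx : ‖x‖ = 1) (u : E) : perpProj x u = u - ⟪x, u⟫ • x := by
  rw [perpProj, Submodule.starProjection_orthogonal_val,
    Submodule.starProjection_unit_singleton ℝ hx]

lemma inner_perpProj_self {x : E} (hx : ‖x‖ = 1) (u : E) : ⟪x, perpProj x u⟫ = 0 := by
  rw [perpProj_apply hx, inner_sub_right, inner_smul_right, real_inner_self_eq_norm_sq, hx]
  ring

lemma perpProj_self {x : E} (hx : ‖x‖ = 1) : perpProj x x = 0 := by
  rw [perpProj_apply hx, real_inner_self_eq_norm_sq, hx]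
  simp

variable [FiniteDimensional ℝ E] [MeasurableSpace E] [BorelSpace E]
  {ι : Type*} [Fintype ι] [Nonempty ι]

/-- Projecting the index vectors does not increase the expected maximum. The projection of `u` is
the mean of `u` and its reflection, and the Gaussian measure is invariant under reflections. -/
lemma integral_maxInner_perpProj_le (x : E) (v : ι → E) :
    ∫ g, maxInner (fun i => perpProj x (v i)) g ∂(stdGaussian E) ≤
      ∫ g, maxInner v g ∂(stdGaussian E) := by
  set R := (ℝ ∙ x)ᗮ.reflection with hR
  have hmap : (stdGaussian E).map R = stdGaussian E := stdGaussian_map R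
  have hv := integrable_maxInner v
  have hvR : Integrable (fun g => maxInner v (R g)) (stdGaussian E) := by
    rw [← hmap] at hv
    exact hv.comp_measurable (by fun_prop)
  have hRint : ∫ g, maxInner v (R g) ∂(stdGaussian E) = ∫ g, maxInner v g ∂(stdGaussian E) := by
    conv_rhs => rw [← hmap]
    rw [integral_map (by fun_prop) (continuous_maxInner v).aestronglyMeasurable]
  have hle : ∀ g, maxInner (fun i => perpProj x (v i)) g ≤
      (maxInner v g + maxInner v (R g)) / 2 := by
    intro g
    obtain ⟨i, hi⟩ := exists_maxInner_eq (fun i => perpProj x (v i)) g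
    have h1 := inner_le_maxInner v g i
    have h2 := inner_le_maxInner v (R g) i
    have h3 : ⟪R g, v i⟫ = 2 * ⟪g, perpProj x (v i)⟫ - ⟪g, v i⟫ := by
      rw [hR, Submodule.reflection_apply, inner_sub_left, two_smul, inner_add_left,
        Submodule.inner_starProjection_left_eq_right]
      ring
    rw [hi]
    linarith
  calc _ ≤ ∫ g, (maxInner v g + maxInner v (R g)) / 2 ∂(stdGaussian E) :=
        integral_mono (integrable_maxInner _) ((hv.add hvR).div_const 2) hle
    _ = _ := by
        rw [integral_div, integral_add hv hvR, hRint]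
        ring

end Projection

section MeanWidth

variable {d : ℕ} {K : Set (EuclideanSpace ℝ (Fin d))} {x : EuclideanSpace ℝ (Fin d)}

lemma integral_maxInner_sub_le_meanWidth (hx : x ∈ K) (hw : gaussianMeanWidth K ≠ ⊤)
    {ι : Type*} [Fintype ι] [Nonempty ι] (u : ι → EuclideanSpace ℝ (Fin d)) (hu : ∀ i, u i ∈ K) :
    ∫ g, maxInner (fun i => u i - x) g ∂(stdGaussian (EuclideanSpace ℝ (Fin d))) ≤
      (gaussianMeanWidth K).toReal := by
  rw [← ENNReal.ofReal_le_iff_le_toReal hw]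
  refine (ofReal_integral_le_lintegral_ofReal (integrable_maxInner _)).trans ?_
  refine lintegral_mono fun g => ?_
  obtain ⟨i, hi⟩ := exists_maxInner_eq (fun i => u i - x) g
  rw [hi]
  exact le_iSup₂_of_le (u i) (hu i) (le_iSup₂_of_le x hx le_rfl)

/-- Gaussian concentration for the supremum of `⟪g, u - x⟫` over `u ∈ K ∩ 𝔹`, with the increments
projected to `xᗮ`. The supremum is over an infinite set; inner regularity of the open event reduces
it to finite subsets. -/
lemma measure_exists_lt_inner_perpProj_le (hxK : x ∈ K) (hx : ‖x‖ = 1)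
    (hw : gaussianMeanWidth K ≠ ⊤) {r : ℝ} (hr : 0 ≤ r) :
    stdGaussian (EuclideanSpace ℝ (Fin d)) {g | ∃ u ∈ K ∩ Metric.closedBall 0 1,
        (gaussianMeanWidth K).toReal + r < ⟪g, perpProj x (u - x)⟫} ≤
      ENNReal.ofReal (Real.exp (-(r ^ 2 / 5))) := by
  classical
  set B := K ∩ Metric.closedBall (0 : EuclideanSpace ℝ (Fin d)) 1 with hB
  set a := (gaussianMeanWidth K).toReal + r with ha
  set U : EuclideanSpace ℝ (Fin d) → Set (EuclideanSpace ℝ (Fin d)) :=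
    fun u => {g | a < ⟪g, perpProj x (u - x)⟫} with hU
  have hUo : ∀ u, IsOpen (U u) := fun u => isOpen_lt (by fun_prop) (by fun_prop)
  have hset : {g | ∃ u ∈ B, a < ⟪g, perpProj x (u - x)⟫} = ⋃ u : B, U u := by
    ext g; simp [hU]
  rw [hset, (isOpen_iUnion fun u : B => hUo u).measure_eq_iSup_isCompact]
  refine iSup₂_le fun Q hQ => iSup_le fun hQc => ?_
  obtain ⟨t, ht⟩ := hQc.elim_finite_subcover (fun u : B => U u) (fun u => hUo u) hQ
  let xB : B := ⟨x, hxK, by simp [hx]⟩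
  let T := insert xB t
  have : Nonempty T := ⟨⟨xB, Finset.mem_insert_self _ _⟩⟩
  let v : T → EuclideanSpace ℝ (Fin d) := fun u => perpProj x ((u : B) - x)
  have hv : ∀ u, ‖v u‖ ≤ 1 := by
    intro u
    have h1 : v u = perpProj x (u : B) := by simp [v, map_sub, perpProj_self hx]
    rw [h1]
    refine (Submodule.norm_starProjection_apply_le _ _).trans ?_
    simpa using (u : B).2.2
  have hmean : ∫ g, maxInner v g ∂(stdGaussian (EuclideanSpace ℝ (Fin d))) ≤
      (gaussianMeanWidth K).toReal :=
    (integral_maxInner_perpProj_le x _).trans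
      (integral_maxInner_sub_le_meanWidth hxK hw (fun u : T => ((u : B) : EuclideanSpace ℝ (Fin d)))
        fun u => (u : B).2.1)
  refine (measure_mono fun g hg => ?_).trans
    (measure_maxInner_deviation_le v hv hr (ε := 1) (by norm_num))
  obtain ⟨u, hu, hgu⟩ := Set.mem_iUnion₂.1 (ht hg)
  have h1 : a < ⟪g, perpProj x ((u : EuclideanSpace ℝ (Fin d)) - x)⟫ := hgu
  have h2 := inner_le_maxInner v g ⟨u, Finset.mem_insert_of_mem hu⟩
  simp only [v] at h2
  show r ≤ 1 * (maxInner v g - _)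
  linarith

end MeanWidth

/-! ### The space of measurement matrices -/

section Tensor

variable {m k d : ℕ}

/-- The pairing `(r, u) ↦ (r_i ⊗ u)_i`. The inner product of `w`, read as a family of matrices
`W i`, with `tensor r u` is `∑ i, ⟪r i, W i u⟫`. -/
noncomputable def tensor : (Fin m → EuclideanSpace ℝ (Fin k)) →ₗ[ℝ] EuclideanSpace ℝ (Fin d) →ₗ[ℝ]
    EuclideanSpace ℝ (Fin m × Fin k × Fin d) :=
  LinearMap.mk₂ ℝ (fun r u => WithLp.toLp 2 fun p => r p.1 p.2.1 * u p.2.2)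
    (fun _ _ _ => by ext; simp [add_mul]) (fun _ _ _ => by ext; simp [mul_assoc])
    (fun _ _ _ => by ext; simp [mul_add]) (fun _ _ _ => by ext; simp; ring)

lemma tensor_apply (r : Fin m → EuclideanSpace ℝ (Fin k)) (u : EuclideanSpace ℝ (Fin d))
    (p : Fin m × Fin k × Fin d) : tensor r u p = r p.1 p.2.1 * u p.2.2 := rfl

lemma inner_tensor_tensor (r r' : Fin m → EuclideanSpace ℝ (Fin k))
    (u u' : EuclideanSpace ℝ (Fin d)) :
    ⟪tensor r u, tensor r' u'⟫ = (∑ i, ⟪r i, r' i⟫) * ⟪u, u'⟫ := by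
  simp only [PiLp.inner_apply, tensor_apply, RCLike.inner_apply, conj_trivial]
  rw [Fintype.sum_prod_type, Finset.sum_mul]
  refine Finset.sum_congr rfl fun i _ => ?_
  rw [Fintype.sum_prod_type, Finset.sum_mul_sum]
  exact Finset.sum_congr rfl fun a _ => Finset.sum_congr rfl fun b _ => by ring

lemma inner_tensor (w : EuclideanSpace ℝ (Fin m × Fin k × Fin d))
    (r : Fin m → EuclideanSpace ℝ (Fin k)) (u : EuclideanSpace ℝ (Fin d)) :
    ⟪w, tensor r u⟫ =
      ∑ i, ⟪r i, (Matrix.of fun a b => w (i, a, b)).toEuclideanLin u⟫ := by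
  simp only [PiLp.inner_apply, tensor_apply, RCLike.inner_apply, conj_trivial]
  rw [Fintype.sum_prod_type]
  refine Finset.sum_congr rfl fun i _ => ?_
  rw [Fintype.sum_prod_type]
  refine Finset.sum_congr rfl fun a _ => ?_
  simp only [Matrix.toLpLin_apply, Matrix.mulVec, dotProduct, Matrix.of_apply]
  rw [Finset.sum_mul]
  exact Finset.sum_congr rfl fun b _ => by ring

lemma norm_tensor_sq (r : Fin m → EuclideanSpace ℝ (Fin k)) (u : EuclideanSpace ℝ (Fin d)) :
    ‖tensor r u‖ ^ 2 = (∑ i, ‖r i‖ ^ 2) * ‖u‖ ^ 2 := by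
  rw [← real_inner_self_eq_norm_sq, inner_tensor_tensor]
  simp_rw [real_inner_self_eq_norm_sq]

lemma norm_tensor_single (i : Fin m) (r : EuclideanSpace ℝ (Fin k)) {x : EuclideanSpace ℝ (Fin d)}
    (hx : ‖x‖ = 1) : ‖tensor (Pi.single i r) x‖ = ‖r‖ := by
  rw [← sq_eq_sq₀ (norm_nonneg _) (norm_nonneg _), norm_tensor_sq, hx,
    Finset.sum_eq_single i (fun j _ hj => by simp [hj]) (by simp)]
  simp

lemma inner_tensor_single (w : EuclideanSpace ℝ (Fin m × Fin k × Fin d)) (i : Fin m)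
    (r : EuclideanSpace ℝ (Fin k)) (u : EuclideanSpace ℝ (Fin d)) :
    ⟪w, tensor (Pi.single i r) u⟫ =
      ⟪r, (Matrix.of fun a b => w (i, a, b)).toEuclideanLin u⟫ := by
  rw [inner_tensor, Finset.sum_eq_single i (fun j _ hj => by simp [hj]) (by simp)]
  simp

lemma tensor_eq_sum_single (r : Fin m → EuclideanSpace ℝ (Fin k)) (u : EuclideanSpace ℝ (Fin d)) :
    tensor r u = ∑ i, tensor (Pi.single i (r i)) u := by
  conv_lhs => rw [← Finset.univ_sum_single r, map_sum, LinearMap.sum_apply]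

end Tensor

/-! ### Signal and noise parts of the decoder's objective -/

section Sensing

variable {m q d : ℕ} {s : Fin q → EuclideanSpace ℝ (Fin (q - 1))} {x : EuclideanSpace ℝ (Fin d)}

/-- The vector representing `w ↦ (1 / √m) ∑ i, ⟪s (σ i), W i u⟫`, as a function of `u`. -/
noncomputable def sensingCLM (s : Fin q → EuclideanSpace ℝ (Fin (q - 1))) (σ : Fin m → Fin q) :
    EuclideanSpace ℝ (Fin d) →L[ℝ] EuclideanSpace ℝ (Fin m × Fin (q - 1) × Fin d) :=
  LinearMap.toContinuousLinearMap ((√(m : ℝ))⁻¹ • tensor fun i => s (σ i))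

lemma sensingCLM_apply (σ : Fin m → Fin q) (u : EuclideanSpace ℝ (Fin d)) :
    sensingCLM s σ u = (√(m : ℝ))⁻¹ • tensor (fun i => s (σ i)) u := rfl

lemma IsSimplexCode.norm_sensingCLM (hs : IsSimplexCode q s) (hm : 0 < m) (σ : Fin m → Fin q)
    (u : EuclideanSpace ℝ (Fin d)) : ‖sensingCLM s σ u‖ = ‖u‖ := by
  have hm' : (0 : ℝ) < m := by exact_mod_cast hm
  rw [← sq_eq_sq₀ (norm_nonneg _) (norm_nonneg _), sensingCLM_apply, norm_smul, mul_pow,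
    norm_tensor_sq]
  simp only [hs.norm_sq]
  rw [Real.norm_of_nonneg (by positivity), inv_pow, Real.sq_sqrt hm'.le]
  simp
  field_simp

/-- The event that `σ` is a sensing of `x` by the matrices encoded in `w`. -/
def sensingEvent (s : Fin q → EuclideanSpace ℝ (Fin (q - 1))) (x : EuclideanSpace ℝ (Fin d))
    (σ : Fin m → Fin q) : Set (EuclideanSpace ℝ (Fin m × Fin (q - 1) × Fin d)) :=
  {w | ∀ i k, ⟪w, tensor (Pi.single i (s k)) x⟫ ≤ ⟪w, tensor (Pi.single i (s (σ i))) x⟫}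

lemma mem_sensingEvent_iff {w : EuclideanSpace ℝ (Fin m × Fin (q - 1) × Fin d)}
    {σ : Fin m → Fin q} :
    w ∈ sensingEvent s x σ ↔ IsSensing s (fun i => Matrix.of fun a b => w (i, a, b)) x σ := by
  simp only [sensingEvent, Set.mem_ofPred_eq, inner_tensor_single]
  rfl

lemma measurableSet_sensingEvent (σ : Fin m → Fin q) :
    MeasurableSet (sensingEvent s x σ : Set (EuclideanSpace ℝ (Fin m × Fin (q - 1) × Fin d))) := by
  refine IsClosed.measurableSet ?_
  simp only [sensingEvent, Set.ofPred_forall]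
  exact isClosed_iInter fun i => isClosed_iInter fun k => isClosed_le (by fun_prop) (by fun_prop)

/-- Ties between quantized measurements have probability zero. -/
lemma IsSimplexCode.sum_measure_sensingEvent_le_one (hs : IsSimplexCode q s) (hq : 2 ≤ q)
    (hx : ‖x‖ = 1) :
    ∑ σ : Fin m → Fin q, stdGaussian (EuclideanSpace ℝ (Fin m × Fin (q - 1) × Fin d))
      (sensingEvent s x σ) ≤ 1 := by
  rw [← measure_univ (μ := stdGaussian (EuclideanSpace ℝ (Fin m × Fin (q - 1) × Fin d)))]
  refine sum_measure_le_measure_univ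
    (fun σ _ => (measurableSet_sensingEvent σ).nullMeasurableSet) fun σ _ τ _ hστ => ?_
  obtain ⟨i, hi⟩ := Function.ne_iff.1 hστ
  have hne : tensor (Pi.single i (s (σ i) - s (τ i))) x ≠ 0 := by
    rw [← norm_ne_zero_iff, norm_tensor_single i _ hx, norm_ne_zero_iff]
    exact hs.sub_ne_zero hq hi
  refine measure_mono_null ?_ (stdGaussian_inner_eq_zero hne)
  rintro w ⟨h1, h2⟩
  rw [Set.mem_ofPred_eq, Pi.single_sub, map_sub, LinearMap.sub_apply, real_inner_comm,
    inner_sub_right, sub_eq_zero]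
  exact le_antisymm (h2 i (σ i)) (h1 i (τ i))

/-- The map collecting the numbers `⟪s k, W i x⟫` is the adjoint of this one. -/
noncomputable def measurementCLM (m : ℕ) (s : Fin q → EuclideanSpace ℝ (Fin (q - 1)))
    (x : EuclideanSpace ℝ (Fin d)) : EuclideanSpace ℝ (Fin m × Fin q) →L[ℝ]
      EuclideanSpace ℝ (Fin m × Fin (q - 1) × Fin d) :=
  ∑ p : Fin m × Fin q, (innerSL ℝ (EuclideanSpace.single p (1 : ℝ))).smulRight
    (tensor (Pi.single p.1 (s p.2)) x)

lemma measurementCLM_apply (t : EuclideanSpace ℝ (Fin m × Fin q)) :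
    measurementCLM m s x t = ∑ p, t p • tensor (Pi.single p.1 (s p.2)) x := by
  simp [measurementCLM, EuclideanSpace.inner_single_left]

lemma measurementCLM_single (p : Fin m × Fin q) :
    measurementCLM m s x (EuclideanSpace.single p 1) = tensor (Pi.single p.1 (s p.2)) x := by
  rw [measurementCLM_apply, Finset.sum_eq_single p (fun p' _ hp' => by simp [hp']) (by simp)]
  simp

lemma sensingEvent_eq_preimage (σ : Fin m → Fin q) :
    sensingEvent s x σ = ContinuousLinearMap.adjoint (measurementCLM m s x) ⁻¹'
      {z | ∀ i k, z (i, k) ≤ z (i, σ i)} := by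
  have h : ∀ w p, (ContinuousLinearMap.adjoint (measurementCLM m s x) w) p =
      ⟪w, tensor (Pi.single p.1 (s p.2)) x⟫ := by
    intro w p
    rw [← measurementCLM_single, ← ContinuousLinearMap.adjoint_inner_left]
    simp [EuclideanSpace.inner_single_right]
  ext w
  simp only [sensingEvent, Set.mem_ofPred_eq, Set.mem_preimage, h]

/-- The noise `(1 / √m) ∑ i, (W i)ᵀ (s (y i))`, projected to `xᗮ`, is independent of the
measurements `W i x`, hence of the data-dependent labels `y`. Summation over the values of `y`
reduces its deviations to those of a standard Gaussian vector. -/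
lemma IsSimplexCode.measure_noise_le (hs : IsSimplexCode q s) (hq : 2 ≤ q) (hm : 0 < m)
    {K : Set (EuclideanSpace ℝ (Fin d))} (hxK : x ∈ K) (hx : ‖x‖ = 1)
    (hw : gaussianMeanWidth K ≠ ⊤) {r : ℝ} (hr : 0 ≤ r) :
    stdGaussian (EuclideanSpace ℝ (Fin m × Fin (q - 1) × Fin d))
      (⋃ σ : Fin m → Fin q, sensingEvent s x σ ∩ {w | ∃ u ∈ K ∩ Metric.closedBall 0 1,
        (gaussianMeanWidth K).toReal + r < ⟪w, sensingCLM s σ (perpProj x (u - x))⟫}) ≤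
      ENNReal.ofReal (Real.exp (-(r ^ 2 / 5))) := by
  set a := (gaussianMeanWidth K).toReal + r
  set D : Set (EuclideanSpace ℝ (Fin d)) :=
    {h | ∃ u ∈ K ∩ Metric.closedBall 0 1, a < ⟪h, u - x⟫} with hD
  have hDm : MeasurableSet D := by
    have : D = ⋃ u ∈ K ∩ Metric.closedBall 0 1, {h | a < ⟪h, u - x⟫} := by ext; simp [hD]
    rw [this]
    exact (isOpen_biUnion fun u _ => isOpen_lt (by fun_prop) (by fun_prop)).measurableSet
  have hZm : ∀ σ : Fin m → Fin q,
      MeasurableSet {z : EuclideanSpace ℝ (Fin m × Fin q) | ∀ i k, z (i, k) ≤ z (i, σ i)} := by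
    intro σ
    refine IsClosed.measurableSet ?_
    simp only [Set.ofPred_forall]
    exact isClosed_iInter fun i => isClosed_iInter fun k => isClosed_le (by fun_prop) (by fun_prop)
  have hterm : ∀ σ : Fin m → Fin q,
      stdGaussian (EuclideanSpace ℝ (Fin m × Fin (q - 1) × Fin d))
        (sensingEvent s x σ ∩ {w | ∃ u ∈ K ∩ Metric.closedBall 0 1,
          a < ⟪w, sensingCLM s σ (perpProj x (u - x))⟫}) ≤
      stdGaussian (EuclideanSpace ℝ (Fin m × Fin (q - 1) × Fin d)) (sensingEvent s x σ) *
        ENNReal.ofReal (Real.exp (-(r ^ 2 / 5))) := by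
    intro σ
    have hpre : {w | ∃ u ∈ K ∩ Metric.closedBall 0 1,
          a < ⟪w, sensingCLM s σ (perpProj x (u - x))⟫} =
        ContinuousLinearMap.adjoint ((sensingCLM s σ).comp (perpProj x)) ⁻¹' D := by
      ext w
      simp only [hD, Set.mem_ofPred_eq, Set.mem_preimage, ContinuousLinearMap.adjoint_inner_left,
        ContinuousLinearMap.comp_apply]
    have hpre2 : {w | ∃ u ∈ K ∩ Metric.closedBall 0 1,
          a < ⟪w, sensingCLM s σ (perpProj x (u - x))⟫} =
        ContinuousLinearMap.adjoint (sensingCLM s σ) ⁻¹' {g | ∃ u ∈ K ∩ Metric.closedBall 0 1,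
          a < ⟪g, perpProj x (u - x)⟫} := by
      ext w
      simp only [Set.mem_ofPred_eq, Set.mem_preimage, ContinuousLinearMap.adjoint_inner_left]
    have hSm : MeasurableSet {g | ∃ u ∈ K ∩ Metric.closedBall 0 1,
          a < ⟪g, perpProj x (u - x)⟫} := by
      have : {g | ∃ u ∈ K ∩ Metric.closedBall 0 1, a < ⟪g, perpProj x (u - x)⟫} =
          ⋃ u ∈ K ∩ Metric.closedBall 0 1, {g | a < ⟪g, perpProj x (u - x)⟫} := by ext; simp
      rw [this]
      exact (isOpen_biUnion fun u _ => isOpen_lt (by fun_prop) (by fun_prop)).measurableSet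
    have hind := indepFun_adjoint_stdGaussian (measurementCLM m s x)
      ((sensingCLM s σ).comp (perpProj x)) fun t u => by
        rw [measurementCLM_apply, sum_inner]
        refine Finset.sum_eq_zero fun p _ => ?_
        rw [ContinuousLinearMap.comp_apply, sensingCLM_apply, real_inner_smul_left,
          real_inner_smul_right, inner_tensor_tensor, inner_perpProj_self hx]
        ring
    calc _ = stdGaussian (EuclideanSpace ℝ (Fin m × Fin (q - 1) × Fin d)) (sensingEvent s x σ) *
          stdGaussian (EuclideanSpace ℝ (Fin m × Fin (q - 1) × Fin d))
            {w | ∃ u ∈ K ∩ Metric.closedBall 0 1,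
              a < ⟪w, sensingCLM s σ (perpProj x (u - x))⟫} := by
          rw [sensingEvent_eq_preimage, hpre]
          exact hind.measure_inter_preimage_eq_mul _ _ (hZm σ) hDm
      _ = stdGaussian (EuclideanSpace ℝ (Fin m × Fin (q - 1) × Fin d)) (sensingEvent s x σ) *
          stdGaussian (EuclideanSpace ℝ (Fin d)) {g | ∃ u ∈ K ∩ Metric.closedBall 0 1,
            a < ⟪g, perpProj x (u - x)⟫} := by
          rw [hpre2, ← Measure.map_apply (by fun_prop) hSm,
            stdGaussian_map_adjoint_of_isometry _ (hs.norm_sensingCLM hm σ)]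
      _ ≤ _ := by
          gcongr
          exact measure_exists_lt_inner_perpProj_le hxK hx hw hr
  refine (measure_iUnion_fintype_le _ _).trans ((Finset.sum_le_sum fun σ _ => hterm σ).trans ?_)
  rw [← Finset.sum_mul]
  exact mul_le_of_le_one_left zero_le (hs.sum_measure_sensingEvent_le_one hq hx)

/-- The mean of the signal strength `max_σ (1 / √m) ∑ i, ⟪s (σ i), W i x⟫` is `√m` times the
expected maximum of the simplex code. -/
lemma le_integral_maxInner_sensingCLM [NeZero q] (hx : ‖x‖ = 1) :
    √(m : ℝ) * ∫ z, maxInner s z ∂(stdGaussian (EuclideanSpace ℝ (Fin (q - 1)))) ≤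
      ∫ w, maxInner (fun σ : Fin m → Fin q => sensingCLM s σ x) w
        ∂(stdGaussian (EuclideanSpace ℝ (Fin m × Fin (q - 1) × Fin d))) := by
  let B : Fin m → EuclideanSpace ℝ (Fin (q - 1)) →L[ℝ]
      EuclideanSpace ℝ (Fin m × Fin (q - 1) × Fin d) := fun i =>
    LinearMap.toContinuousLinearMap ((tensor.flip x) ∘ₗ
      LinearMap.single ℝ (fun _ => EuclideanSpace ℝ (Fin (q - 1))) i)
  have hB : ∀ i r, B i r = tensor (Pi.single i r) x := fun _ _ => rfl
  have hBmap : ∀ i, (stdGaussian (EuclideanSpace ℝ (Fin m × Fin (q - 1) × Fin d))).map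
      (ContinuousLinearMap.adjoint (B i)) = stdGaussian (EuclideanSpace ℝ (Fin (q - 1))) :=
    fun i => stdGaussian_map_adjoint_of_isometry _ fun r => by rw [hB, norm_tensor_single i r hx]
  have hint : ∀ i, Integrable (fun w => maxInner s (ContinuousLinearMap.adjoint (B i) w))
      (stdGaussian (EuclideanSpace ℝ (Fin m × Fin (q - 1) × Fin d))) := by
    intro i
    have h := integrable_maxInner s
    rw [← hBmap i] at h
    exact h.comp_measurable (by fun_prop)
  have hval : ∀ i, ∫ w, maxInner s (ContinuousLinearMap.adjoint (B i) w)
        ∂(stdGaussian (EuclideanSpace ℝ (Fin m × Fin (q - 1) × Fin d))) =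
      ∫ z, maxInner s z ∂(stdGaussian (EuclideanSpace ℝ (Fin (q - 1)))) := by
    intro i
    rw [← hBmap i, integral_map (by fun_prop) (continuous_maxInner s).aestronglyMeasurable]
  have hle : ∀ w, (√(m : ℝ))⁻¹ * ∑ i, maxInner s (ContinuousLinearMap.adjoint (B i) w) ≤
      maxInner (fun σ : Fin m → Fin q => sensingCLM s σ x) w := by
    intro w
    choose σ hσ using fun i => exists_maxInner_eq s (ContinuousLinearMap.adjoint (B i) w)
    refine le_trans (le_of_eq ?_) (inner_le_maxInner _ w σ)
    rw [sensingCLM_apply, inner_smul_right, tensor_eq_sum_single, inner_sum]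
    congr 1
    refine Finset.sum_congr rfl fun i _ => ?_
    rw [hσ i, ContinuousLinearMap.adjoint_inner_left, hB]
  have h := integral_mono ((integrable_finsetSum _ fun i _ => hint i).const_mul _)
    (integrable_maxInner _) hle
  rw [integral_const_mul, integral_finsetSum _ fun i _ => hint i] at h
  simp only [hval, Finset.sum_const, Finset.card_univ, Fintype.card_fin, nsmul_eq_mul] at h
  rwa [← mul_assoc, inv_mul_eq_div, Real.div_sqrt] at h

/-- The deterministic part of the argument: optimality of `xhat` gives
`(1 - ⟪x, xhat⟫) * signal ≤ noise`. -/
lemma norm_sub_sq_mul_le_of_isDecoded [NeZero q] (hm : 0 < m)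
    {K : Set (EuclideanSpace ℝ (Fin d))}
    (hxK : x ∈ K) (hx : ‖x‖ = 1) {w : EuclideanSpace ℝ (Fin m × Fin (q - 1) × Fin d)}
    {y : Fin m → Fin q} (hy : w ∈ sensingEvent s x y) {xhat : EuclideanSpace ℝ (Fin d)}
    (hdec : IsDecoded s K (fun i => Matrix.of fun a b => w (i, a, b)) y xhat) {b : ℝ} (hb : 0 ≤ b)
    (hsignal : b ≤ maxInner (fun σ : Fin m → Fin q => sensingCLM s σ x) w) {a : ℝ}
    (hnoise : ⟪w, sensingCLM s y (perpProj x (xhat - x))⟫ ≤ a) :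
    b * ‖xhat - x‖ ^ 2 ≤ 2 * a := by
  have hm' : (0 : ℝ) < m := by exact_mod_cast hm
  have hobj : ∀ u, decoderObjective s (fun i => Matrix.of fun a b => w (i, a, b)) y u =
      (√(m : ℝ))⁻¹ * ⟪w, sensingCLM s y u⟫ := by
    intro u
    rw [decoderObjective, ← inner_tensor, sensingCLM_apply, inner_smul_right, ← mul_assoc,
      ← mul_inv, Real.mul_self_sqrt hm'.le, one_div]
  have hopt : ⟪w, sensingCLM s y x⟫ ≤ ⟪w, sensingCLM s y xhat⟫ := by
    have h := hdec.2 x ⟨hxK, by simp [hx]⟩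
    rw [hobj, hobj] at h
    exact le_of_mul_le_mul_left h (by positivity)
  -- A sensing maximizes every summand of the signal separately.
  have hmax : maxInner (fun σ : Fin m → Fin q => sensingCLM s σ x) w ≤ ⟪w, sensingCLM s y x⟫ := by
    obtain ⟨σ, hσ⟩ := exists_maxInner_eq (fun σ : Fin m → Fin q => sensingCLM s σ x) w
    rw [hσ, sensingCLM_apply, sensingCLM_apply, inner_smul_right, inner_smul_right,
      tensor_eq_sum_single, tensor_eq_sum_single (fun i => s (y i)), inner_sum, inner_sum]
    gcongr with i
    exact hy i (σ i)
  rw [perpProj_apply hx, map_sub, map_sub, map_smul, inner_sub_right, inner_sub_right,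
    inner_smul_right, inner_sub_right, real_inner_self_eq_norm_sq, hx] at hnoise
  have hball : ‖xhat‖ ^ 2 ≤ 1 := pow_le_one₀ (norm_nonneg _) (by simpa using hdec.1.2)
  have hnorm : ‖xhat - x‖ ^ 2 ≤ 2 * (1 - ⟪x, xhat⟫) := by
    rw [norm_sub_sq_real, hx, real_inner_comm]
    linarith
  have h1 : 0 ≤ 1 - ⟪x, xhat⟫ := by nlinarith [sq_nonneg ‖xhat - x‖]
  have h2 : b * (1 - ⟪x, xhat⟫) ≤ ⟪w, sensingCLM s y x⟫ * (1 - ⟪x, xhat⟫) :=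
    mul_le_mul_of_nonneg_right (hsignal.trans hmax) h1
  nlinarith [mul_le_mul_of_nonneg_left hnorm hb]

end Sensing

/-! ### Recovery with high probability -/

/-- The entries of a Gaussian matrix family form a standard Gaussian vector. -/
lemma IsGaussianMatrixFamily.hasLaw_toLp {Ω : Type*} [MeasurableSpace Ω] {μ : Measure Ω}
    [IsProbabilityMeasure μ] {m k d : ℕ} {W : Fin m → Ω → Matrix (Fin k) (Fin d) ℝ}
    (h : IsGaussianMatrixFamily μ W) :
    HasLaw (fun ω => WithLp.toLp 2 fun p : Fin m × Fin k × Fin d => W p.1 ω p.2.1 p.2.2)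
      (stdGaussian (EuclideanSpace ℝ (Fin m × Fin k × Fin d))) μ := by
  have hm : ∀ p : Fin m × Fin k × Fin d, AEMeasurable (fun ω => W p.1 ω p.2.1 p.2.2) μ :=
    fun p => (h.hasLaw p.1 p.2.1 p.2.2).aemeasurable
  have hpi := h.indep.map_fun_eq_pi_map hm
  simp only [(h.hasLaw _ _ _).map_eq] at hpi
  have hm' := aemeasurable_pi_iff.2 hm
  refine ⟨by fun_prop, ?_⟩
  rw [← map_pi_eq_stdGaussian, ← hpi, AEMeasurable.map_map_of_aemeasurable (by fun_prop) hm']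
  rfl

theorem theorem1 :
    ∃ C c : ℝ, 0 < C ∧ 0 < c ∧
      ∀ (q d m : ℕ), 2 ≤ q →
      ∀ (s : Fin q → EuclideanSpace ℝ (Fin (q - 1))), IsSimplexCode q s →
      ∀ (K : Set (EuclideanSpace ℝ (Fin d))) (x : EuclideanSpace ℝ (Fin d)),
        x ∈ K → ‖x‖ = 1 →
      ∀ (δ : ℝ), 0 < δ →
        ENNReal.ofReal (C * (δ ^ 2)⁻¹) * gaussianMeanWidth K ^ 2 ≤ (m : ℝ≥0∞) →
      ∀ {Ω : Type*} [MeasurableSpace Ω] (μ : Measure Ω) [IsProbabilityMeasure μ]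
        (W : Fin m → Ω → Matrix (Fin (q - 1)) (Fin d) ℝ),
        IsGaussianMatrixFamily μ W →
        ∃ A : Set Ω, MeasurableSet A ∧
          1 - 8 * Real.exp (-(c * δ ^ 2 * m)) ≤ μ.real A ∧
          ∀ ω ∈ A, ∀ (y : Fin m → Fin q) (xhat : EuclideanSpace ℝ (Fin d)),
            IsSensing s (fun i => W i ω) x y →
            IsDecoded s K (fun i => W i ω) y xhat →
              ‖xhat - x‖ ^ 2 ≤ δ / Real.sqrt (Real.log q) := by
  obtain ⟨c₁, hc₁, hlam⟩ := exists_sqrt_log_le_integral_maxInner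
  refine ⟨64 / c₁ ^ 2, c₁ ^ 2 / 320, by positivity, by positivity, ?_⟩
  intro q d m hq s hs K x hxK hx δ hδ hwidth Ω _ μ _ W hW
  -- `C = 64 / c₁ ^ 2` makes the width at most `c₁ δ √m / 8`; the fluctuation `r` of the noise is
  -- allowed the same size, which fixes `c = (c₁ / 8) ^ 2 / 5`.
  have : NeZero q := ⟨by lia⟩
  have hlog : 0 < Real.log q := Real.log_pos (by exact_mod_cast hq)
  set L := √(Real.log q) with hL
  have hL0 : 0 < L := Real.sqrt_pos.2 hlog
  rcases Nat.eq_zero_or_pos m with rfl | hm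
  · exact ⟨∅, MeasurableSet.empty, by simp, by simp⟩
  by_cases hδL : 4 * L < δ
  · -- The claim is weaker than the bound by the diameter of the unit ball.
    refine ⟨Set.univ, MeasurableSet.univ, by simp [(Real.exp_pos _).le], ?_⟩
    intro ω _ y xhat _ hdec
    have h1 : ‖xhat‖ ≤ 1 := by simpa using hdec.1.2
    have h2 : ‖xhat - x‖ ≤ 2 := (norm_sub_le _ _).trans (by linarith)
    rw [le_div_iff₀ hL0]
    have h3 : ‖xhat - x‖ ^ 2 ≤ 2 ^ 2 := pow_le_pow_left₀ (norm_nonneg _) h2 2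
    nlinarith [mul_le_mul_of_nonneg_right h3 hL0.le]
  rw [not_lt] at hδL
  have hm' : (0 : ℝ) < m := by exact_mod_cast hm
  have hsm : 0 < √(m : ℝ) := Real.sqrt_pos.2 hm'
  have hCpos : 0 < 64 / c₁ ^ 2 * (δ ^ 2)⁻¹ := by positivity
  have hw : gaussianMeanWidth K ≠ ⊤ := by
    intro h
    rw [h, ENNReal.top_pow two_ne_zero, ENNReal.mul_top (by simpa using hCpos)] at hwidth
    exact ENNReal.natCast_ne_top m (top_le_iff.1 hwidth)
  have hwle : (gaussianMeanWidth K).toReal ≤ c₁ / 8 * δ * √(m : ℝ) := by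
    have h := ENNReal.toReal_mono (ENNReal.natCast_ne_top m) hwidth
    rw [ENNReal.toReal_mul, ENNReal.toReal_ofReal hCpos.le, ENNReal.toReal_pow,
      ENNReal.toReal_natCast] at h
    refine abs_le_of_sq_le_sq' ?_ (by positivity) |>.2
    rw [mul_pow, Real.sq_sqrt hm'.le]
    calc (gaussianMeanWidth K).toReal ^ 2 = (c₁ / 8 * δ) ^ 2 *
          (64 / c₁ ^ 2 * (δ ^ 2)⁻¹ * (gaussianMeanWidth K).toReal ^ 2) := by field_simp; ring
      _ ≤ _ := by gcongr
  set H := EuclideanSpace ℝ (Fin m × Fin (q - 1) × Fin d)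
  set lam := ∫ z, maxInner s z ∂(stdGaussian (EuclideanSpace ℝ (Fin (q - 1))))
  have hlam' : c₁ * L ≤ lam := hlam q hq s hs
  have hlam0 : 0 < lam := lt_of_lt_of_le (by positivity) hlam'
  set F : H → ℝ := maxInner fun σ : Fin m → Fin q => sensingCLM s σ x
  have hF : √(m : ℝ) * lam ≤ ∫ w, F w ∂(stdGaussian H) := le_integral_maxInner_sensingCLM hx
  set r := c₁ / 8 * δ * √(m : ℝ) with hr
  have hr0 : 0 ≤ r := by positivity
  set weak : Set H := {w | √(m : ℝ) * lam / 2 ≤ -1 * (F w - ∫ w, F w ∂(stdGaussian H))}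
  set noisy : Set H := ⋃ σ : Fin m → Fin q, sensingEvent s x σ ∩
    {w | ∃ u ∈ K ∩ Metric.closedBall 0 1,
      (gaussianMeanWidth K).toReal + r < ⟪w, sensingCLM s σ (perpProj x (u - x))⟫}
  set η := Real.exp (-(c₁ ^ 2 / 320 * δ ^ 2 * m)) with hη
  have hη0 : 0 < η := Real.exp_pos _
  have hweak : stdGaussian H weak ≤ ENNReal.ofReal η := by
    refine (measure_maxInner_deviation_le _ (fun σ => ?_) (by positivity) (by norm_num)).trans ?_
    · rw [hs.norm_sensingCLM hm, hx]
    · -- Here `δ ≤ 4 √(log q)` turns the rate `lam ^ 2 m` into the rate `δ ^ 2 m`.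
      refine ENNReal.ofReal_le_ofReal (Real.exp_le_exp.2 (neg_le_neg ?_))
      rw [div_pow, mul_pow, Real.sq_sqrt hm'.le]
      have h1 : c₁ * δ ≤ 4 * lam := by nlinarith
      have h2 : (c₁ * δ) ^ 2 ≤ (4 * lam) ^ 2 := pow_le_pow_left₀ (by positivity) h1 2
      nlinarith
  have hnoisy : stdGaussian H noisy ≤ ENNReal.ofReal η := by
    refine (hs.measure_noise_le hq hm hxK hx hw hr0).trans (le_of_eq ?_)
    rw [hη, hr, mul_pow, Real.sq_sqrt hm'.le]
    ring_nf
  have hbad : stdGaussian H (weak ∪ noisy) ≤ ENNReal.ofReal (2 * η) := by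
    rw [two_mul, ENNReal.ofReal_add hη0.le hη0.le]
    exact (measure_union_le _ _).trans (add_le_add hweak hnoisy)
  have hX := hW.hasLaw_toLp
  set X : Ω → H := fun ω => WithLp.toLp 2 fun p => W p.1 ω p.2.1 p.2.2
  have hμ : μ (X ⁻¹' (weak ∪ noisy)) ≤ ENNReal.ofReal (2 * η) := by
    rw [← hX.map_eq] at hbad
    exact (Measure.le_map_apply hX.aemeasurable _).trans hbad
  refine ⟨(toMeasurable μ (X ⁻¹' (weak ∪ noisy)))ᶜ, (measurableSet_toMeasurable _ _).compl, ?_, ?_⟩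
  · rw [probReal_compl_eq_one_sub (measurableSet_toMeasurable _ _), measureReal_def,
      measure_toMeasurable]
    have := ENNReal.toReal_le_of_le_ofReal (by positivity) hμ
    linarith
  intro ω hω y xhat hy hdec
  have hω' : X ω ∉ weak ∪ noisy := fun h => hω (subset_toMeasurable _ _ h)
  rw [Set.mem_union, not_or] at hω'
  have hyX : X ω ∈ sensingEvent s x y := mem_sensingEvent_iff.2 hy
  have hsignal : √(m : ℝ) * (c₁ * L) / 2 ≤ F (X ω) := by
    have h1 : -1 * (F (X ω) - ∫ w, F w ∂(stdGaussian H)) < √(m : ℝ) * lam / 2 := not_le.1 hω'.1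
    nlinarith [mul_le_mul_of_nonneg_left hlam' hsm.le]
  have hnoise : ⟪X ω, sensingCLM s y (perpProj x (xhat - x))⟫ ≤
      (gaussianMeanWidth K).toReal + r := by
    by_contra h
    exact hω'.2 (Set.mem_iUnion.2 ⟨y, hyX, xhat, hdec.1, not_le.1 h⟩)
  have hfinal := norm_sub_sq_mul_le_of_isDecoded hm hxK hx hyX (xhat := xhat) hdec
    (by positivity) hsignal hnoise
  rw [le_div_iff₀ hL0]
  have hpos : 0 < √(m : ℝ) * c₁ / 2 := by positivity
  refine le_of_mul_le_mul_left ?_ hpos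
  linarith
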